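/- Let $p$ be a prime, let $F/\mathbb{Q}_p$ be a finite extension with ring of integers $\mathcal{O}_F$ and let $n \ge 0$. Put $R=\mathcal{O}_F[[X_1,\ldots,X_n]]$, let $I\subseteq R$ be an ideal and $A=R/I$. Let $\mu_{p^\infty}$ denote the group of roots of unity of $p$-power order in an algebraic closure $\overline{F}$ of $F$. For $T\subseteq\{1,\ldots,n\}$ and $\zeta_i\in\mu_{p^\infty}$ ($1\le i\le n$), the intersection of the hyperplanes $X_i=\zeta_i-1$, $i\in T$, is the closed subscheme of $\mathrm{Spec}(R)$ whose ideal is the contraction to $R$ of the ideal $(X_i+1-\zeta_i : i\in T)$ of $\mathcal{O}_K[[X_1,\ldots,X_n]]$, where $K\subseteq\overline F$ is a finite extension of $F$ containing the $\zeta_i$ (the case $T=\emptyset$, giving $\mathrm{Spec}(R)$ itself, is allowed). The set of special points $\mathcal{S}_A\subseteq \mathrm{Spec}(A)$ consists of the primes of $A$ whose preimage in $R$ is such an ideal with $T=\{1,\ldots,n\}$, that is, of the points of $\mathrm{Spec}(A)$ given by the $n$-tuples $(\zeta_1-1,\ldots,\zeta_n-1)$ with $\zeta_i\in\mu_{p^\infty}$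 at which all elements of $I$ vanish. A multiplicative change of variables on $R$ is a finite composition of swaps $X_i\leftrightarrow X_j$ and of substitutions $$X_i\mapsto (1+X_i)\prod_{1\le j<i}(1+X_j)^{B_{ij}}-1\qquad(1\le i\le n),\qquad B_{ij}\in\mathbb{Z}_p,$$ where $(1+X)^b=\sum_{k\ge 0}\binom{b}{k}X^k$. A special multiplicative subscheme of $\mathrm{Spec}(R)$ is a closed subscheme that after a multiplicative change of variables is a finite union of intersections of hyperplanes as above, where the union of closed subschemes is defined by the intersection of their ideals. Dimensions are taken relative to the one-dimensional base $\mathrm{Spec}(\mathcal{O}_F)$: a space is said to be $d$-dimensional if its Krull dimension is $d+1$ (so the closure of a special point is $0$-dimensional and $\mathrm{Spec}(R)$ is $n$-dimensional). Then for every integer $d\ge 0$: if the Zariski closure of $\mathcal{S}_A$ in $\mathrm{Spec}(A)$ is $d$-dimensional, then $\mathrm{Spec}(A)$ contains a $d$-dimensional special multiplicative subscheme (as a closed subscheme). -/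

import Mathlib

namespace FormalTorus

/-- The ring of integers `𝓞_F` of an extension `F` of `ℚ_p`: the elements integral over `ℤ_p`. -/
abbrev IntegerRing (p : ℕ) [Fact p.Prime] (F : Type*) [Field F] [Algebra ℤ_[p] F] : Type _ :=
  integralClosure ℤ_[p] F

/-- The inclusion `𝓞_F → 𝓞_K` for a field `F ⊆ K` inside the fixed algebraic closure of `F`. -/
noncomputable def integerRingMap (p : ℕ) [Fact p.Prime] {F : Type*} [Field F] [Algebra ℤ_[p] F]
    (K : IntermediateField F (AlgebraicClosure F)) : IntegerRing p F →+* IntegerRing p K :=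
  ((IsScalarTower.toAlgHom ℤ_[p] F K).mapIntegralClosure : IntegerRing p F →ₐ[ℤ_[p]] _)

section Slices

variable (p : ℕ) [Fact p.Prime] {F : Type*} [Field F] [Algebra ℤ_[p] F] {n : ℕ}

/-- The ideal of `𝓞_F[[X_1, …, X_n]]` cutting out the intersection of the hyperplanes
`X_i = ζ_i - 1`, `i ∈ T`. The `ζ_i` lie in `𝓞_K` for some extension `K` of `F`, so the ideal
`(X_i - (ζ_i - 1) : i ∈ T)` is formed in `𝓞_K[[X_1, …, X_n]]` and contracted, that is, we take
the (scheme-theoretic) image of the intersection in `Spec 𝓞_F[[X_1, …, X_n]]`. -/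
noncomputable def sliceIdeal (K : IntermediateField F (AlgebraicClosure F))
    (T : Set (Fin n)) (ζ : Fin n → IntegerRing p K) :
    Ideal (MvPowerSeries (Fin n) (IntegerRing p F)) :=
  (Ideal.span ((fun i ↦ MvPowerSeries.X i - MvPowerSeries.C (ζ i - 1)) '' T)).comap
    (MvPowerSeries.map (integerRingMap p K))

/-- `Q` is the ideal of an intersection of hyperplanes `X_i = ζ_i - 1`, where `i` runs through the
set `T` of coordinates and the `ζ_i` are roots of unity of `p`-power order in a finite extension
of `F`. -/
def IsTorsionSlice (T : Set (Fin n)) (Q : Ideal (MvPowerSeries (Fin n) (IntegerRing p F))) :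
    Prop :=
  ∃ (K : IntermediateField F (AlgebraicClosure F)) (_ : FiniteDimensional F K)
    (ζ : Fin n → IntegerRing p K),
    (∀ i, ∃ k : ℕ, ζ i ^ p ^ k = 1) ∧ Q = sliceIdeal p K T ζ

/-- The set `𝒮_A ⊆ Spec A` of special points, for `A = 𝓞_F[[X_1, …, X_n]] / I`: the primes
`(X_1 + 1 - ζ_1, …, X_n + 1 - ζ_n)` with all `ζ_i` roots of unity of `p`-power order. -/
def specialPoints (I : Ideal (MvPowerSeries (Fin n) (IntegerRing p F))) :
    Set (PrimeSpectrum (MvPowerSeries (Fin n) (IntegerRing p F) ⧸ I)) :=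
  {x | IsTorsionSlice p Set.univ (x.asIdeal.comap (Ideal.Quotient.mk I))}

end Slices

section ChangeOfVariables

variable {p : ℕ} [Fact p.Prime] {F : Type*} [Field F] [Algebra ℤ_[p] F] {n : ℕ}

/-- The power series `(1 + X_j) ^ b = ∑ k, (b choose k) X_j ^ k` for `b ∈ ℤ_p`. -/
noncomputable def onePlusXPow (F : Type*) [Field F] [Algebra ℤ_[p] F] (j : Fin n) (b : ℤ_[p]) :
    MvPowerSeries (Fin n) (IntegerRing p F) :=
  (PowerSeries.binomialSeries (IntegerRing p F) b).subst
    (MvPowerSeries.X j : MvPowerSeries (Fin n) (IntegerRing p F))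

/-- The power series `(1 + X_i) ∏_{j < i} (1 + X_j) ^ (B_{ij}) - 1`. -/
noncomputable def triangularSeries (F : Type*) [Field F] [Algebra ℤ_[p] F]
    (B : Fin n → Fin n → ℤ_[p]) (i : Fin n) : MvPowerSeries (Fin n) (IntegerRing p F) :=
  (1 + MvPowerSeries.X i) * (∏ j ∈ Finset.Iio i, onePlusXPow F j (B i j)) - 1

theorem constantCoeff_onePlusXPow (j : Fin n) (b : ℤ_[p]) :
    MvPowerSeries.constantCoeff (onePlusXPow F j b) = 1 := by
  have hX : PowerSeries.HasSubst (MvPowerSeries.X j : MvPowerSeries (Fin n) (IntegerRing p F)) :=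
    PowerSeries.HasSubst.X j
  have h1 : MvPowerSeries.constantCoeff ((PowerSeries.binomialSeries (IntegerRing p F) b - 1).subst
      (MvPowerSeries.X j : MvPowerSeries (Fin n) (IntegerRing p F))) = 0 :=
    PowerSeries.constantCoeff_subst_eq_zero (MvPowerSeries.constantCoeff_X j) _ (by simp)
  rw [← PowerSeries.coe_substAlgHom hX, map_sub, map_one, map_sub, map_one, sub_eq_zero,
    PowerSeries.coe_substAlgHom hX] at h1
  exact h1

theorem constantCoeff_triangularSeries (B : Fin n → Fin n → ℤ_[p]) (i : Fin n) :
    MvPowerSeries.constantCoeff (triangularSeries F B i) = 0 := by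
  simp [triangularSeries, constantCoeff_onePlusXPow]

/-- The substitution `X_i ↦ (1 + X_i) ∏_{j < i} (1 + X_j) ^ (B_{ij}) - 1`, `1 ≤ i ≤ n`. -/
noncomputable def triangularSubst (F : Type*) [Field F] [Algebra ℤ_[p] F]
    (B : Fin n → Fin n → ℤ_[p]) :
    MvPowerSeries (Fin n) (IntegerRing p F) →ₐ[IntegerRing p F]
      MvPowerSeries (Fin n) (IntegerRing p F) :=
  MvPowerSeries.substAlgHom
    (MvPowerSeries.hasSubst_of_constantCoeff_zero (constantCoeff_triangularSeries (F := F) B))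

/-- The substitution that swaps `X_i` and `X_j`. -/
noncomputable def swapSubst (p : ℕ) [Fact p.Prime] (F : Type*) [Field F] [Algebra ℤ_[p] F]
    (i j : Fin n) :
    MvPowerSeries (Fin n) (IntegerRing p F) →ₐ[IntegerRing p F]
      MvPowerSeries (Fin n) (IntegerRing p F) :=
  MvPowerSeries.substAlgHom
    (a := fun k ↦ (MvPowerSeries.X (Equiv.swap i j k) : MvPowerSeries (Fin n) (IntegerRing p F)))
    (MvPowerSeries.hasSubst_of_constantCoeff_zero fun _ ↦ MvPowerSeries.constantCoeff_X _)

variable (p) in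
/-- Multiplicative changes of variables on `𝓞_F[[X_1, …, X_n]]`: the finite compositions of swaps
of two variables and of the substitutions `X_i ↦ (1 + X_i) ∏_{j < i} (1 + X_j) ^ (B_{ij}) - 1`
with `B_{ij} ∈ ℤ_p`. -/
inductive IsMulChangeOfVariables :
    (MvPowerSeries (Fin n) (IntegerRing p F) →ₐ[IntegerRing p F]
      MvPowerSeries (Fin n) (IntegerRing p F)) → Prop
  | swap (i j : Fin n) : IsMulChangeOfVariables (swapSubst p F i j)
  | triangular (B : Fin n → Fin n → ℤ_[p]) : IsMulChangeOfVariables (triangularSubst F B)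
  | comp {σ τ} : IsMulChangeOfVariables σ → IsMulChangeOfVariables τ →
      IsMulChangeOfVariables (σ.comp τ)

variable (p) in
/-- The closed subscheme `V(J)` of `Spec 𝓞_F[[X_1, …, X_n]]` is a special multiplicative
subscheme: after a multiplicative change of variables it is a finite union of intersections of
hyperplanes `X_i = ζ_i - 1` with `ζ_i` a root of unity of `p`-power order. A union of closed
subschemes is given by the intersection of their ideals. -/
def IsSpecialSubscheme (J : Ideal (MvPowerSeries (Fin n) (IntegerRing p F))) : Prop :=
  ∃ σ : MvPowerSeries (Fin n) (IntegerRing p F) →ₐ[IntegerRing p F]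
      MvPowerSeries (Fin n) (IntegerRing p F),
    IsMulChangeOfVariables p σ ∧
    ∃ s : Set (Ideal (MvPowerSeries (Fin n) (IntegerRing p F))),
      s.Finite ∧ (∀ Q ∈ s, ∃ T : Set (Fin n), IsTorsionSlice p T Q) ∧ J.map σ = sInf s

end ChangeOfVariables

/-- `X` has dimension `d` relative to the one-dimensional base `Spec 𝓞_F`: its Krull dimension
is `d + 1`. In this normalization `Spec 𝓞_F[[X_1, …, X_n]]` has dimension `n`, the closure of a
special point has dimension `0`, and the translate of a formal subtorus by a torsion point has
the dimension of the subtorus. -/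
def HasRelDim (X : Type*) [TopologicalSpace X] (d : ℕ) : Prop :=
  topologicalKrullDim X = d + 1

end FormalTorus

/-! This is a Manin–Mumford argument for the formal torus. Each special point is the kernel of
evaluation at a tuple `w` of `p`-power roots of unity. Give the set of these tuples the topology
induced from `Spec R`, and let `V` be the common zeros of `I` in it. The core claim
(`hasSpecialClosure_of_isClosed`) is that the closure of `V` in `Spec R` is a finite union of
slices, each up to a multiplicative change of variables.

By noetherianity `V` may be taken irreducible. Suppose it is stable under all torsion points
supported in the coordinates below `r`. If the orders of the remaining coordinates are bounded on
`V`, then `V` is a finite union of full sets of torsion points of slices, and these are dense in the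
slices (`mem_sliceIdeal_of_forall_evalAt`). If they are unbounded, Galois theory supplies
translations. With `c = [F : ℚ_p]!`, every `c`-th power of a unit modulo `p ^ m` is realised by an
automorphism over `F`, so `V` contains `w ^ (1 + x t) ^ c` when `w ^ p ^ m = 1` and `p ∣ x`. For `p
^ m ∣ x ^ 2` this is `w * η ^ t` with `η = w ^ (c x)`. Only finitely many `η` of controlled order
occur, and the set of `w` whose whole orbit under `η` lies in `V` is closed, although translation by
`η` is not defined over `F` (`exists_forall_evalAt_mul_pow_eq_zero_iff`). Irreducibility therefore
makes one `η` work on all of `V`.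

Thus `V` has translations of unbounded order. König's lemma turns them into a coherent sequence of
`p`-power roots, that is, a one-parameter subgroup. A swap and a shear with `ℤ_p` exponents carry it
to the `r`-th coordinate axis, and `r` increases.

A slice with fixed coordinates `T` has Krull dimension `|Tᶜ| + 1`. If the closure of the special
points has relative dimension `d`, some slice in the union has at least that dimension, and fixing
further coordinates cuts it down to exactly `d`. -/

namespace FormalTorus

open MvPowerSeries

/-! ### Homomorphisms out of power series rings: uniqueness and existence. -/

section PowerSeriesRings

variable {n : ℕ}

/-- Polynomial approximation in purely algebraic form, so that it can be pushed through ring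
homomorphisms not known to be continuous. -/
theorem exists_eq_coe_add_sum_X_pow_mul {A : Type*} [CommRing A] (M : ℕ)
    (f : MvPowerSeries (Fin n) A) :
    ∃ (q : MvPolynomial (Fin n) A) (g : Fin n → MvPowerSeries (Fin n) A),
      f = q + ∑ i, X i ^ (M + 1) * g i := by
  classical
  let m : Fin n →₀ ℕ := Finsupp.equivFunOnFinite.symm fun _ ↦ M
  -- A monomial with some exponent above `M` is charged to the first such variable, so that it is
  -- counted only once.
  let P : Fin n → (Fin n →₀ ℕ) → Prop := fun i e ↦ M < e i ∧ ∀ j < i, e j ≤ M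
  obtain ⟨g, hg⟩ : ∃ g : Fin n → MvPowerSeries (Fin n) A, ∀ i e, coeff e (g i) =
      if P i (e + Finsupp.single i (M + 1)) then coeff (e + Finsupp.single i (M + 1)) f else 0 :=
    ⟨fun i e ↦ if P i (e + Finsupp.single i (M + 1)) then
      coeff (e + Finsupp.single i (M + 1)) f else 0, fun _ _ ↦ rfl⟩
  refine ⟨trunc' A m f, g, ?_⟩
  ext e
  have hterm : ∀ i : Fin n, coeff e (X i ^ (M + 1) * g i) = if P i e then coeff e f else 0 := by
    intro i
    rw [X_pow_eq, coeff_monomial_mul, one_mul]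
    by_cases h : Finsupp.single i (M + 1) ≤ e
    · rw [if_pos h, hg, tsub_add_cancel_of_le h]
    · rw [if_neg h, if_neg]
      rintro ⟨h1, -⟩
      exact h (Finsupp.single_le_iff.2 h1)
  rw [map_add, map_sum, Finset.sum_congr rfl fun i _ ↦ hterm i, MvPolynomial.coeff_coe,
    coeff_trunc']
  by_cases h : e ≤ m
  · rw [if_pos h, Finset.sum_eq_zero, add_zero]
    rintro i -
    rw [if_neg]
    rintro ⟨h1, -⟩
    exact absurd (h i) (by simpa [m] using h1)
  · rw [if_neg h, zero_add]
    have hne : (Finset.univ.filter fun i ↦ M < e i).Nonempty := by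
      by_contra hcon
      refine h fun i ↦ ?_
      by_contra hi
      exact hcon ⟨i, by simpa [m] using hi⟩
    set i₀ := (Finset.univ.filter fun i ↦ M < e i).min' hne with hi₀
    have hmem : M < e i₀ := by
      simpa using Finset.min'_mem _ hne
    have hP : P i₀ e := ⟨hmem, fun j hj ↦ by
      by_contra hcon
      exact absurd (Finset.min'_le _ j (by simpa using hcon)) (not_le.2 hj)⟩
    rw [Finset.sum_eq_single i₀, if_pos hP]
    · rintro i - hi
      rw [if_neg]
      rintro ⟨h1, h2⟩
      rcases lt_or_gt_of_ne hi with hlt | hlt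
      · exact absurd (hP.2 i hlt) (not_le.2 h1)
      · exact absurd (h2 i₀ hlt) (not_le.2 hmem)
    · simp

/-- The two maps agree on polynomials, and the tail of order `∑ N i * k + 1` goes into `𝔞 ^ k` under
both. Their difference lies in every `𝔞 ^ k`. All later identifications of evaluations and
substitutions rest on this. -/
theorem ringHom_ext_of_isHausdorff {A B : Type*} [CommRing A] [CommRing B] (𝔞 : Ideal B)
    [IsHausdorff 𝔞 B] {φ ψ : MvPowerSeries (Fin n) A →+* B} (hC : ∀ a, φ (C a) = ψ (C a))
    (hX : ∀ i, φ (X i) = ψ (X i)) (hnil : ∀ i, ∃ N, φ (X i) ^ N ∈ 𝔞) : φ = ψ := by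
  choose N hN using hnil
  ext f
  rw [← sub_eq_zero]
  refine IsHausdorff.haus (I := 𝔞) inferInstance _ fun k ↦ ?_
  rw [SModEq.zero, smul_eq_mul, Ideal.mul_top]
  obtain ⟨q, g, hg⟩ := exists_eq_coe_add_sum_X_pow_mul (∑ i, N i * k) f
  have hq : φ.comp MvPolynomial.coeToMvPowerSeries.ringHom =
      ψ.comp MvPolynomial.coeToMvPowerSeries.ringHom :=
    MvPolynomial.ringHom_ext (fun a ↦ by simpa using hC a) fun i ↦ by simpa using hX i
  have hq' : φ (q : MvPowerSeries (Fin n) A) = ψ q := by simpa using DFunLike.congr_fun hq q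
  have key : ∀ i, φ (X i) ^ (∑ i, N i * k + 1) ∈ 𝔞 ^ k := fun i ↦ by
    have h1 : N i * k ≤ ∑ i, N i * k + 1 :=
      (Finset.single_le_sum (f := fun i ↦ N i * k) (fun _ _ ↦ Nat.zero_le _)
        (Finset.mem_univ i)).trans (Nat.le_succ _)
    rw [← Nat.add_sub_cancel' h1, pow_add, pow_mul]
    exact Ideal.mul_mem_right _ _ (Ideal.pow_mem_pow (hN i) k)
  rw [hg, map_add, map_add, hq', map_sum, map_sum, add_sub_add_left_eq_sub,
    ← Finset.sum_sub_distrib]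
  refine Ideal.sum_mem _ fun i _ ↦ ?_
  rw [map_mul, map_mul, map_pow, map_pow, ← hX, ← mul_sub]
  exact Ideal.mul_mem_right _ _ (key i)

noncomputable section

/-- The ideal of power series generated by a constant `π` and the variables. -/
def augIdeal {S : Type*} [CommRing S] (n : ℕ) (π : S) : Ideal (MvPowerSeries (Fin n) S) :=
  Ideal.span {C π} ⊔ Ideal.span (Set.range X)

variable {S : Type*} [CommRing S]

theorem C_mem_augIdeal (π : S) : C π ∈ augIdeal n π :=
  Ideal.mem_sup_left (Ideal.subset_span rfl)

theorem X_mem_augIdeal (π : S) (i : Fin n) : X i ∈ augIdeal n π :=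
  Ideal.mem_sup_right (Ideal.subset_span ⟨i, rfl⟩)

/-- The power series whose coefficient at `e` is divisible by `π ^ (M - |e|)`. -/
def coeffDvdIdeal (n : ℕ) (π : S) (M : ℕ) : Ideal (MvPowerSeries (Fin n) S) where
  carrier := {h | ∀ e, π ^ (M - e.degree) ∣ coeff e h}
  zero_mem' e := by simp
  add_mem' ha hb e := by rw [map_add]; exact dvd_add (ha e) (hb e)
  smul_mem' c h hh e := by
    classical
    rw [smul_eq_mul, coeff_mul]
    refine Finset.dvd_sum fun x hx ↦ Dvd.dvd.mul_left ((pow_dvd_pow _ ?_).trans (hh x.2)) _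
    rw [← Finset.HasAntidiagonal.mem_antidiagonal.1 hx, map_add]
    omega

/-- Turns membership in powers of `(π, X)` into divisibility of coefficients; both separatedness and
density are read off from it. -/
theorem augIdeal_pow_le (π : S) (M : ℕ) : augIdeal n π ^ M ≤ coeffDvdIdeal n π M := by
  induction M with
  | zero => intro h _ e; simp
  | succ M ih =>
    rw [pow_succ', augIdeal, Ideal.sup_mul, sup_le_iff]
    constructor
    · refine Ideal.span_singleton_mul_le_iff.2 fun h hh e ↦ ?_
      rw [coeff_C_mul]
      refine (pow_dvd_pow _ ?_).trans
        ((pow_succ' π (M - e.degree)).symm ▸ mul_dvd_mul_left π (ih hh e))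
      omega
    · refine Ideal.mul_le.2 fun x hx h hh ↦ ?_
      induction hx using Submodule.span_induction with
      | mem x hx =>
        obtain ⟨i, rfl⟩ := hx
        intro e
        rw [X, coeff_monomial_mul, one_mul]
        split_ifs with hle
        · refine (pow_dvd_pow _ ?_).trans (ih hh (e - Finsupp.single i 1))
          have : e.degree = (e - Finsupp.single i 1).degree + 1 := by
            conv_lhs => rw [← tsub_add_cancel_of_le hle, map_add, Finsupp.degree_single]
          omega
        · exact dvd_zero _
      | zero => simp
      | add x y _ _ hx hy => rw [add_mul]; exact add_mem hx hy
      | smul c x _ hx => rw [smul_eq_mul, mul_assoc]; exact Ideal.mul_mem_left _ _ hx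

theorem eq_zero_of_forall_pow_dvd {π : S} [IsHausdorff (Ideal.span {π}) S] {x : S}
    (hx : ∀ k, π ^ k ∣ x) : x = 0 :=
  IsHausdorff.haus (I := Ideal.span {π}) inferInstance _ fun k ↦ by
    rw [SModEq.zero, smul_eq_mul, Ideal.mul_top, Ideal.span_singleton_pow]
    exact Ideal.mem_span_singleton.2 (hx k)

theorem isHausdorff_of_forall_pow_dvd {π : S} (h : ∀ x : S, (∀ k, π ^ k ∣ x) → x = 0) :
    IsHausdorff (Ideal.span {π}) S :=
  ⟨fun x hx ↦ h x fun k ↦ by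
    have := hx k
    rwa [SModEq.zero, smul_eq_mul, Ideal.mul_top, Ideal.span_singleton_pow,
      Ideal.mem_span_singleton] at this⟩

instance isHausdorff_augIdeal (π : S) [IsHausdorff (Ideal.span {π}) S] :
    IsHausdorff (augIdeal n π) (MvPowerSeries (Fin n) S) := by
  refine ⟨fun h hh ↦ ?_⟩
  ext e
  refine eq_zero_of_forall_pow_dvd (π := π) fun k ↦ ?_
  have := hh (k + e.degree)
  rw [SModEq.zero, smul_eq_mul, Ideal.mul_top] at this
  simpa using augIdeal_pow_le π _ this e

/-- With `y = (1 + x) ^ p ^ k - 1`, the next term is `p * y` plus a multiple of `y ^ 2`, and both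
gain a factor from `𝔞`. -/
theorem one_add_pow_prime_pow_sub_one_mem {p : ℕ} {𝔞 : Ideal S} (hp : (p : S) ∈ 𝔞)
    {x : S} (hx : x ∈ 𝔞) (k : ℕ) : (1 + x) ^ p ^ k - 1 ∈ 𝔞 ^ (k + 1) := by
  induction k with
  | zero => simpa using hx
  | succ k ih =>
    set y := (1 + x) ^ p ^ k - 1 with hy
    obtain ⟨c, hc⟩ := Polynomial.powAddExpansion 1 y p
    have h1 : (1 + x) ^ p ^ (k + 1) - 1 = p * y + c * (y * y) := by
      rw [pow_succ, pow_mul, show (1 + x) ^ p ^ k = 1 + y by rw [hy]; ring, hc]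
      simp only [one_pow]
      ring
    rw [h1]
    refine add_mem ?_ (Ideal.mul_mem_left _ _ ?_)
    · rw [pow_succ' 𝔞 (k + 1)]
      exact Ideal.mul_mem_mul hp ih
    · rw [pow_succ' 𝔞 (k + 1)]
      exact Ideal.mul_mem_mul (Ideal.pow_le_self (Nat.succ_ne_zero _) ih) ih

open WithPiTopology in
-- Constant terms need only be nilpotent modulo `π`, which admits `ζ - 1`: the `a i` are then
-- topologically nilpotent for the product of `π`-adic topologies, and evaluation converges by
-- completeness.
theorem exists_ringHom_X_eq (π : S) [IsAdicComplete (Ideal.span {π}) S] {A : Type*} [CommRing A]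
    (ρ : A →+* S) {m : ℕ} (a : Fin n → MvPowerSeries (Fin m) S)
    (ha : ∀ i, ∃ N : ℕ, π ∣ constantCoeff (a i) ^ N) :
    ∃ φ : MvPowerSeries (Fin n) A →+* MvPowerSeries (Fin m) S,
      (∀ c, φ (C c) = C (ρ c)) ∧ ∀ i, φ (X i) = a i := by
  let : WithIdeal S := ⟨Ideal.span {π}⟩
  obtain ⟨hc, ht⟩ := (IsAdic.isAdicComplete_iff (R := S) (I := Ideal.span {π}) rfl).1 inferInstance
  have hnil : ∀ i, IsTopologicallyNilpotent (a i) := fun i ↦ by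
    apply LinearTopology.isTopologicallyNilpotent_of_constantCoeff
    obtain ⟨N, hN⟩ := ha i
    have h1 : IsTopologicallyNilpotent (constantCoeff (a i) ^ N) :=
      WithIdeal.isTopologicallyNilpotent_of_mem (Ideal.mem_span_singleton.2 hN)
    simp_rw [IsTopologicallyNilpotent, IsLinearTopology.hasBasis_ideal.tendsto_right_iff] at h1 ⊢
    intro I hI
    obtain ⟨k, hk⟩ := (h1 I hI).exists
    filter_upwards [Filter.eventually_ge_atTop (N * k)] with j hj
    rw [← Nat.add_sub_cancel' hj, pow_add, pow_mul]
    exact I.mul_mem_right _ hk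
  have heval : HasEval a := ⟨hnil, by simp⟩
  refine ⟨(eval₂Hom (R := S) (φ := C) continuous_C heval).comp (MvPowerSeries.map ρ),
    fun c ↦ by simp [coe_eval₂Hom], fun i ↦ by simp [coe_eval₂Hom]⟩

theorem isPrecomplete_of_basis {ι R M : Type*} [Finite ι] [CommRing R] [AddCommGroup M]
    [Module R M] (b : Module.Basis ι R M) (a : R) [IsPrecomplete (Ideal.span {a}) R] :
    IsPrecomplete (Ideal.span {a}) M := by
  have key : ∀ (k : ℕ) (x : M), x ∈ (Ideal.span {a} ^ k • ⊤ : Submodule R M) ↔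
      ∀ i, a ^ k ∣ b.repr x i := by
    intro k x
    rw [Ideal.span_singleton_pow, Submodule.ideal_span_singleton_smul,
      Submodule.mem_smul_pointwise_iff_exists]
    constructor
    · rintro ⟨y, -, rfl⟩ i
      simp
    · intro h
      choose c hc using h
      have := Fintype.ofFinite ι
      refine ⟨∑ i, c i • b i, trivial, b.repr.injective (Finsupp.ext fun i ↦ ?_)⟩
      simp only [map_smul, Finsupp.smul_apply, Module.Basis.repr_sum_self, hc, smul_eq_mul]
  refine ⟨fun f hf ↦ ?_⟩
  have hf' : ∀ i, ∃ L : R, ∀ k, b.repr (f k) i ≡ L [SMOD (Ideal.span {a} ^ k • ⊤ : Ideal R)] :=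
    fun i ↦ IsPrecomplete.prec' (fun k ↦ b.repr (f k) i) fun {j k} hjk ↦ by
      have := hf hjk
      rw [SModEq.sub_mem, key] at this
      rw [SModEq.sub_mem, smul_eq_mul, Ideal.mul_top, Ideal.span_singleton_pow,
        Ideal.mem_span_singleton]
      simpa using this i
  choose L hL using hf'
  have := Fintype.ofFinite ι
  refine ⟨∑ i, L i • b i, fun k ↦ ?_⟩
  rw [SModEq.sub_mem, key]
  intro i
  have := hL i k
  rw [SModEq.sub_mem, smul_eq_mul, Ideal.mul_top, Ideal.span_singleton_pow,
    Ideal.mem_span_singleton] at this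
  rwa [map_sub, Finsupp.sub_apply, Module.Basis.repr_sum_self]

/-- Needed beyond rings of integers: it is also applied to `𝓞_F[y] / (y ^ p ^ k - 1)`. -/
theorem isAdicComplete_span_natCast (p : ℕ) [Fact p.Prime] (S : Type*) [CommRing S]
    [Algebra ℤ_[p] S] [Module.Finite ℤ_[p] S] [Module.Free ℤ_[p] S] :
    IsAdicComplete (Ideal.span {(p : S)}) S := by
  have h0 : IsAdicComplete (Ideal.span {(p : ℤ_[p])}) ℤ_[p] := by
    rw [← PadicInt.maximalIdeal_eq_span_p]
    infer_instance
  have h1 : IsAdicComplete (Ideal.span {(p : ℤ_[p])}) S :=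
    { haus' := (IsHausdorff.of_isTorsionFree (Ideal.span {(p : ℤ_[p])}) S (by
        rw [← PadicInt.maximalIdeal_eq_span_p]
        exact Ideal.IsPrime.ne_top inferInstance)).haus'
      prec' := (isPrecomplete_of_basis (Module.Free.chooseBasis ℤ_[p] S) (p : ℤ_[p])).prec' }
  have := (IsAdicComplete.map_algebraMap_iff (S := S) (Ideal.span {(p : ℤ_[p])}) S).2 h1
  rwa [Ideal.map_span, Set.image_singleton, map_natCast] at this

/-- Raising to the power `p ^ k` is additive modulo `p`, so `(u - 1) ^ p ^ k ≡ u ^ p ^ k - 1`. -/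
theorem natCast_dvd_sub_one_pow {p : ℕ} (hp : p.Prime) {u : S} {k : ℕ} (hu : u ^ p ^ k = 1) :
    (p : S) ∣ (u - 1) ^ p ^ k := by
  obtain ⟨r, hr⟩ := exists_add_pow_prime_pow_eq hp (u - 1) 1 k
  rw [sub_add_cancel, hu, one_pow] at hr
  exact ⟨-((u - 1) * 1 * r), by linear_combination -hr⟩

end

end PowerSeriesRings
end FormalTorus

namespace FormalTorus

open MvPowerSeries

/-! ### Rings of integers of finite extensions and of the algebraic closure. -/

section IntegerRings

theorem algebraMap_injective_of_padic (p : ℕ) [Fact p.Prime] (L : Type*) [Field L]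
    [Algebra ℚ_[p] L] [Algebra ℤ_[p] L] [IsScalarTower ℤ_[p] ℚ_[p] L] :
    Function.Injective (algebraMap ℤ_[p] L) := by
  rw [IsScalarTower.algebraMap_eq ℤ_[p] ℚ_[p] L]
  exact (algebraMap ℚ_[p] L).injective.comp (FaithfulSMul.algebraMap_injective _ _)

theorem integerRing_finite (p : ℕ) [Fact p.Prime] (L : Type*) [Field L] [Algebra ℚ_[p] L]
    [Algebra ℤ_[p] L] [IsScalarTower ℤ_[p] ℚ_[p] L] [FiniteDimensional ℚ_[p] L] :
    Module.Finite ℤ_[p] (IntegerRing p L) :=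
  IsIntegralClosure.finite ℤ_[p] ℚ_[p] L _

theorem integerRing_free (p : ℕ) [Fact p.Prime] (L : Type*) [Field L] [Algebra ℚ_[p] L]
    [Algebra ℤ_[p] L] [IsScalarTower ℤ_[p] ℚ_[p] L] [FiniteDimensional ℚ_[p] L] :
    Module.Free ℤ_[p] (IntegerRing p L) :=
  have : FaithfulSMul ℤ_[p] L :=
    (faithfulSMul_iff_algebraMap_injective _ _).2 (algebraMap_injective_of_padic p L)
  IsIntegralClosure.module_free ℤ_[p] ℚ_[p] L _

theorem integerRing_isAdicComplete (p : ℕ) [Fact p.Prime] (L : Type*) [Field L] [Algebra ℚ_[p] L]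
    [Algebra ℤ_[p] L] [IsScalarTower ℤ_[p] ℚ_[p] L] [FiniteDimensional ℚ_[p] L] :
    IsAdicComplete (Ideal.span {(p : IntegerRing p L)}) (IntegerRing p L) := by
  have := integerRing_finite p L
  have := integerRing_free p L
  exact isAdicComplete_span_natCast p _

theorem integerRing_isNoetherianRing (p : ℕ) [Fact p.Prime] (L : Type*) [Field L]
    [Algebra ℚ_[p] L] [Algebra ℤ_[p] L] [IsScalarTower ℤ_[p] ℚ_[p] L] [FiniteDimensional ℚ_[p] L] :
    IsNoetherianRing (IntegerRing p L) := by
  have := integerRing_finite p L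
  exact IsNoetherianRing.of_finite ℤ_[p] _

section Intermediate

variable (p : ℕ) [Fact p.Prime] {F : Type*} [Field F] [Algebra ℚ_[p] F] [Algebra ℤ_[p] F]
  [IsScalarTower ℤ_[p] ℚ_[p] F] (K : IntermediateField F (AlgebraicClosure F))

instance isScalarTower_intermediateField : IsScalarTower ℤ_[p] ℚ_[p] K :=
  .of_algebraMap_eq fun x ↦ by
    rw [IsScalarTower.algebraMap_apply ℤ_[p] F K, IsScalarTower.algebraMap_apply ℚ_[p] F K,
      ← IsScalarTower.algebraMap_apply ℤ_[p] ℚ_[p] F]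

omit [Algebra ℚ_[p] F] [IsScalarTower ℤ_[p] ℚ_[p] F] in
theorem isScalarTower_closure : IsScalarTower ℤ_[p] K (AlgebraicClosure F) :=
  .of_algebraMap_eq fun x ↦ by
    rw [IsScalarTower.algebraMap_apply ℤ_[p] F K, IsScalarTower.algebraMap_apply ℤ_[p] F
      (AlgebraicClosure F), ← IsScalarTower.algebraMap_apply F K]

variable [FiniteDimensional ℚ_[p] F] [FiniteDimensional F K]

instance isAdicComplete_intermediateField :
    IsAdicComplete (Ideal.span {(p : IntegerRing p K)}) (IntegerRing p K) :=
  have : FiniteDimensional ℚ_[p] K := FiniteDimensional.trans ℚ_[p] F K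
  integerRing_isAdicComplete p K

instance isNoetherianRing_intermediateField : IsNoetherianRing (IntegerRing p K) :=
  have : FiniteDimensional ℚ_[p] K := FiniteDimensional.trans ℚ_[p] F K
  integerRing_isNoetherianRing p K

end Intermediate

section Closure

variable (p : ℕ) [Fact p.Prime] (F : Type*) [Field F] [Algebra ℤ_[p] F]

/-- The ring of integers of the algebraic closure of `F`. -/
abbrev ClosureRing : Type _ := IntegerRing p (AlgebraicClosure F)

/-- The inclusion `𝓞_F → 𝓞_E` for `E` the algebraic closure of `F`. -/
noncomputable def baseMap : IntegerRing p F →+* ClosureRing p F :=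
  ((IsScalarTower.toAlgHom ℤ_[p] F (AlgebraicClosure F)).mapIntegralClosure :
    IntegerRing p F →ₐ[ℤ_[p]] _)

variable {F}

/-- The inclusion `𝓞_K → 𝓞_E` for an intermediate field `K` of `E / F`. -/
noncomputable def inclusionMap (K : IntermediateField F (AlgebraicClosure F)) :
    IntegerRing p K →+* ClosureRing p F :=
  have := isScalarTower_closure p K
  ((IsScalarTower.toAlgHom ℤ_[p] K (AlgebraicClosure F)).mapIntegralClosure :
    IntegerRing p K →ₐ[ℤ_[p]] _)

/-- The inclusion `𝓞_K → 𝓞_L` for intermediate fields `K ≤ L`. -/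
noncomputable def leMap {K L : IntermediateField F (AlgebraicClosure F)} (h : K ≤ L) :
    IntegerRing p K →+* IntegerRing p L :=
  (((IntermediateField.inclusion h).restrictScalars ℤ_[p]).mapIntegralClosure :
    IntegerRing p K →ₐ[ℤ_[p]] _)

theorem inclusionMap_injective (K : IntermediateField F (AlgebraicClosure F)) :
    Function.Injective (inclusionMap p K) := fun _ _ h ↦
  Subtype.ext <| Subtype.ext <| congrArg (Subtype.val : ClosureRing p F → AlgebraicClosure F) h

@[simp]
theorem inclusionMap_leMap {K L : IntermediateField F (AlgebraicClosure F)} (h : K ≤ L)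
    (x : IntegerRing p K) : inclusionMap p L (leMap p h x) = inclusionMap p K x := rfl

@[simp]
theorem inclusionMap_integerRingMap (K : IntermediateField F (AlgebraicClosure F))
    (x : IntegerRing p F) : inclusionMap p K (integerRingMap p K x) = baseMap p F x := rfl

theorem exists_inclusionMap_eq (K : IntermediateField F (AlgebraicClosure F)) (x : ClosureRing p F)
    (hx : (x : AlgebraicClosure F) ∈ K) : ∃ y, inclusionMap p K y = x := by
  have := isScalarTower_closure p K
  refine ⟨⟨⟨x, hx⟩, ?_⟩, rfl⟩
  have h1 : IsIntegral ℤ_[p] (algebraMap K (AlgebraicClosure F) ⟨x, hx⟩) := x.2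
  exact (isIntegral_algebraMap_iff (algebraMap K (AlgebraicClosure F)).injective).1 h1

theorem exists_finiteDimensional_inclusionMap_eq {ι : Type*} [Finite ι]
    (K : IntermediateField F (AlgebraicClosure F)) [FiniteDimensional F K]
    (x : ι → ClosureRing p F) :
    ∃ (L : IntermediateField F (AlgebraicClosure F)) (_ : FiniteDimensional F L) (_ : K ≤ L)
      (y : ι → IntegerRing p L), ∀ i, inclusionMap p L (y i) = x i := by
  let L' : IntermediateField F (AlgebraicClosure F) :=
    IntermediateField.adjoin F (Set.range fun i ↦ (x i : AlgebraicClosure F))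
  have : FiniteDimensional F L' := IntermediateField.finiteDimensional_adjoin
    fun y _ ↦ Algebra.IsIntegral.isIntegral y
  have hmem : ∀ i, (x i : AlgebraicClosure F) ∈ K ⊔ L' := fun i ↦
    (le_sup_right : L' ≤ K ⊔ L') (IntermediateField.subset_adjoin _ _ ⟨i, rfl⟩)
  choose y hy using fun i ↦ exists_inclusionMap_eq p (K ⊔ L') (x i) (hmem i)
  exact ⟨K ⊔ L', inferInstance, le_sup_left, y, hy⟩

variable [Algebra ℚ_[p] F] [IsScalarTower ℤ_[p] ℚ_[p] F] [FiniteDimensional ℚ_[p] F]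

/-- An element `x` lies in some finite `K`, and each quotient `x / p ^ k` that is integral lies in
the same `𝓞_K`, which is separated. This separatedness replaces completeness in uniqueness arguments
over the algebraic closure. -/
instance isHausdorff_closureRing :
    IsHausdorff (Ideal.span {(p : ClosureRing p F)}) (ClosureRing p F) := by
  refine isHausdorff_of_forall_pow_dvd fun x hx ↦ ?_
  obtain ⟨K, _, -, y, hy⟩ := exists_finiteDimensional_inclusionMap_eq p
    (⊥ : IntermediateField F (AlgebraicClosure F)) (fun _ : Unit ↦ x)
  have hp : ((p : AlgebraicClosure F)) ≠ 0 := by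
    have := charZero_of_injective_algebraMap (algebraMap ℚ_[p] (AlgebraicClosure F)).injective
    exact_mod_cast (Fact.out : p.Prime).ne_zero
  rw [← hy ()]
  suffices y () = 0 by rw [this, map_zero]
  refine eq_zero_of_forall_pow_dvd (π := (p : IntegerRing p K)) fun k ↦ ?_
  obtain ⟨z, hz⟩ := hx k
  have hzK : (z : AlgebraicClosure F) ∈ K := by
    have h1 : (x : AlgebraicClosure F) = (p : AlgebraicClosure F) ^ k * z := by
      simpa using congrArg Subtype.val hz
    have h2 : (z : AlgebraicClosure F) = ((p : AlgebraicClosure F) ^ k)⁻¹ * x := by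
      rw [h1, inv_mul_cancel_left₀ (pow_ne_zero _ hp)]
    rw [h2, ← hy ()]
    exact mul_mem (inv_mem (pow_mem (natCast_mem K p) k)) (y () : K).2
  obtain ⟨z', rfl⟩ := exists_inclusionMap_eq p K z hzK
  exact ⟨z', inclusionMap_injective p K (by simpa using (hy ()).trans hz)⟩

end Closure

end IntegerRings
end FormalTorus

namespace FormalTorus

open MvPowerSeries

/-! ### Torsion points, evaluation at them, and slice ideals as kernels. -/

section Evaluation

variable {p : ℕ} [Fact p.Prime] {F : Type*} [Field F] [Algebra ℤ_[p] F] {n : ℕ}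

variable (p F) in
/-- The group of roots of unity of `p`-power order, as units of the ring of integers of the
algebraic closure of `F`. -/
def torsionGroup : Subgroup (ClosureRing p F)ˣ where
  carrier := {u | ∃ k : ℕ, u ^ p ^ k = 1}
  one_mem' := ⟨0, one_pow _⟩
  mul_mem' := by
    rintro a b ⟨k, hk⟩ ⟨l, hl⟩
    refine ⟨k + l, ?_⟩
    rw [mul_pow, pow_add, pow_mul, hk, mul_comm (p ^ k), pow_mul, hl, one_pow, one_pow, one_mul]
  inv_mem' := by
    rintro a ⟨k, hk⟩
    exact ⟨k, by rw [inv_pow, hk, inv_one]⟩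

variable (p F n) in
/-- The torsion points of the `n`-dimensional formal torus. -/
abbrev TorsionPoint : Type _ := Fin n → torsionGroup p F

/-- The underlying element of a root of unity. -/
noncomputable def val : torsionGroup p F →* ClosureRing p F :=
  (Units.coeHom _).comp (torsionGroup p F).subtype

theorem val_injective : Function.Injective (val : torsionGroup p F → ClosureRing p F) :=
  fun _ _ h ↦ Subtype.ext (Units.ext h)

theorem exists_pow_eq_one (u : torsionGroup p F) : ∃ k : ℕ, u ^ p ^ k = 1 := by
  obtain ⟨k, hk⟩ := u.2
  exact ⟨k, Subtype.ext hk⟩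

theorem exists_forall_pow_eq_one {ι : Type*} [Finite ι] (w : ι → torsionGroup p F) :
    ∃ k : ℕ, ∀ i, w i ^ p ^ k = 1 := by
  have := Fintype.ofFinite ι
  choose k hk using fun i ↦ exists_pow_eq_one (w i)
  refine ⟨∑ i, k i, fun i ↦ ?_⟩
  rw [← Nat.add_sub_cancel' (Finset.single_le_sum (f := k) (fun _ _ ↦ Nat.zero_le _)
    (Finset.mem_univ i)), pow_add, pow_mul, hk, one_pow]

theorem exists_val_eq {x : ClosureRing p F} {k : ℕ} (hx : x ^ p ^ k = 1) :
    ∃ u : torsionGroup p F, val u = x ∧ u ^ p ^ k = 1 := by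
  have hp : p ^ k ≠ 0 := pow_ne_zero _ (Fact.out : p.Prime).ne_zero
  have h1 : Units.ofPowEqOne x (p ^ k) hx hp ^ p ^ k = 1 := Units.pow_ofPowEqOne hx hp
  exact ⟨⟨Units.ofPowEqOne x (p ^ k) hx hp, k, h1⟩, rfl, Subtype.ext h1⟩

theorem natCast_dvd_val_sub_one_pow (u : torsionGroup p F) :
    ∃ N : ℕ, (p : ClosureRing p F) ∣ (val u - 1) ^ N := by
  obtain ⟨k, hk⟩ := exists_pow_eq_one u
  exact ⟨p ^ k, natCast_dvd_sub_one_pow Fact.out (by rw [← map_pow, hk, map_one])⟩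

theorem exists_inclusionMap_eq_val (K : IntermediateField F (AlgebraicClosure F))
    [FiniteDimensional F K] (w : TorsionPoint p F n) :
    ∃ (L : IntermediateField F (AlgebraicClosure F)) (_ : FiniteDimensional F L) (_ : K ≤ L)
      (z : Fin n → IntegerRing p L), (∀ i, inclusionMap p L (z i) = val (w i)) ∧
        ∀ i, ∃ k : ℕ, z i ^ p ^ k = 1 := by
  obtain ⟨L, hL, h, z, hz⟩ := exists_finiteDimensional_inclusionMap_eq p K fun i ↦ val (w i)
  refine ⟨L, hL, h, z, hz, fun i ↦ ?_⟩
  obtain ⟨k, hk⟩ := exists_pow_eq_one (w i)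
  exact ⟨k, inclusionMap_injective p L (by rw [map_pow, hz, ← map_pow, hk, map_one, map_one])⟩

theorem exists_torsionPoint_of_pow_eq_one (K : IntermediateField F (AlgebraicClosure F))
    {z : Fin n → IntegerRing p K} (hz : ∀ i, ∃ k : ℕ, z i ^ p ^ k = 1) :
    ∃ w : TorsionPoint p F n, ∀ i, inclusionMap p K (z i) = val (w i) := by
  have : ∀ i, ∃ u : torsionGroup p F, inclusionMap p K (z i) = val u := fun i ↦ by
    obtain ⟨k, hk⟩ := hz i
    obtain ⟨u, hu, -⟩ := exists_val_eq (x := inclusionMap p K (z i)) (k := k)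
      (by rw [← map_pow, hk, map_one])
    exact ⟨u, hu.symm⟩
  choose w hw using this
  exact ⟨w, hw⟩

variable [Algebra ℚ_[p] F] [IsScalarTower ℤ_[p] ℚ_[p] F] [FiniteDimensional ℚ_[p] F]

theorem ringHom_ext_of_X_eq_val {A : Type*} [CommRing A]
    {φ ψ : MvPowerSeries (Fin n) A →+* ClosureRing p F} (hC : ∀ a, φ (C a) = ψ (C a))
    {w : TorsionPoint p F n} (hφ : ∀ i, φ (X i) = val (w i) - 1)
    (hψ : ∀ i, ψ (X i) = val (w i) - 1) : φ = ψ := by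
  refine ringHom_ext_of_isHausdorff (Ideal.span {(p : ClosureRing p F)}) hC
    (fun i ↦ (hφ i).trans (hψ i).symm) fun i ↦ ?_
  obtain ⟨N, hN⟩ := natCast_dvd_val_sub_one_pow (w i)
  exact ⟨N, by rw [hφ]; exact Ideal.mem_span_singleton.2 hN⟩

section Partial

variable {K : IntermediateField F (AlgebraicClosure F)} [FiniteDimensional F K]

/-- Convergence is available over finite extensions, so the evaluation is built over a finite `L`
containing `K` and the coordinates of `w`, as a map to series in `m = 0` variables. -/
theorem exists_ringHom_X_eq_val {A : Type*} [CommRing A] (ρ : A →+* IntegerRing p K)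
    (w : TorsionPoint p F n) :
    ∃ φ : MvPowerSeries (Fin n) A →+* ClosureRing p F,
      (∀ c, φ (C c) = inclusionMap p K (ρ c)) ∧ ∀ i, φ (X i) = val (w i) - 1 := by
  obtain ⟨L, _, hKL, z, hz, hz'⟩ := exists_inclusionMap_eq_val K w
  obtain ⟨φ, hφC, hφX⟩ := exists_ringHom_X_eq (n := n) (m := 0) (p : IntegerRing p L)
    ((leMap p hKL).comp ρ) (fun i ↦ C (z i - 1)) fun i ↦ by
      obtain ⟨k, hk⟩ := hz' i
      exact ⟨p ^ k, by simpa using natCast_dvd_sub_one_pow Fact.out hk⟩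
  refine ⟨((inclusionMap p L).comp constantCoeff).comp φ, fun c ↦ ?_, fun i ↦ ?_⟩
  · simp [hφC]
  · simp [hφX, hz]

open Classical in
theorem exists_partialEval (T : Set (Fin n)) {z : Fin n → IntegerRing p K}
    (hz : ∀ i, ∃ k : ℕ, z i ^ p ^ k = 1) :
    ∃ φ : MvPowerSeries (Fin n) (IntegerRing p K) →+* MvPowerSeries (Fin n) (IntegerRing p K),
      (∀ c, φ (C c) = C c) ∧ ∀ i, φ (X i) = if i ∈ T then C (z i - 1) else X i := by
  refine exists_ringHom_X_eq (p : IntegerRing p K) (RingHom.id _)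
    (fun i ↦ if i ∈ T then C (z i - 1) else X i) fun i ↦ ?_
  obtain ⟨k, hk⟩ := hz i
  by_cases h : i ∈ T
  · exact ⟨p ^ k, by simpa [h] using natCast_dvd_sub_one_pow Fact.out hk⟩
  · exact ⟨1, by simp [h]⟩

/-- The substitution `X_i ↦ z_i - 1` for `i ∈ T`. -/
noncomputable def partialEval (T : Set (Fin n)) {z : Fin n → IntegerRing p K}
    (hz : ∀ i, ∃ k : ℕ, z i ^ p ^ k = 1) :
    MvPowerSeries (Fin n) (IntegerRing p K) →+* MvPowerSeries (Fin n) (IntegerRing p K) :=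
  (exists_partialEval T hz).choose

variable (T : Set (Fin n)) {z : Fin n → IntegerRing p K} (hz : ∀ i, ∃ k : ℕ, z i ^ p ^ k = 1)

@[simp]
theorem partialEval_C (c : IntegerRing p K) : partialEval T hz (C c) = C c :=
  (exists_partialEval T hz).choose_spec.1 c

open Classical in
theorem partialEval_X (i : Fin n) :
    partialEval T hz (X i) = if i ∈ T then C (z i - 1) else X i :=
  (exists_partialEval T hz).choose_spec.2 i

theorem augIdeal_le_jacobson {S : Type*} [CommRing S] (π : S) [IsAdicComplete (Ideal.span {π}) S] :
    augIdeal n π ≤ Ideal.jacobson ⊥ := by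
  intro x hx
  rw [Ideal.mem_jacobson_bot]
  intro y
  rw [isUnit_iff_constantCoeff, map_add, map_mul, map_one]
  have h1 : constantCoeff x ∈ Ideal.span {π} := by
    have := augIdeal_pow_le (n := n) π 1 (by rwa [pow_one]) 0
    rw [Ideal.mem_span_singleton]
    simpa using this
  exact Ideal.mem_jacobson_bot.1 (IsAdicComplete.le_jacobson_bot (Ideal.span {π}) h1) _

/-- Modulo the span, the substitution changes no variable, so it induces the quotient map by
uniqueness. The quotient is separated by Krull's intersection theorem, since `(p, X)` lies in the
Jacobson radical of a noetherian ring. -/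
theorem ker_partialEval : RingHom.ker (partialEval T hz) =
    Ideal.span ((fun i ↦ X i - C (z i - 1)) '' T) := by
  set I := Ideal.span ((fun i ↦ X i - C (z i - 1) :
    Fin n → MvPowerSeries (Fin n) (IntegerRing p K)) '' T) with hI
  apply le_antisymm
  · let 𝔞 := (augIdeal n (p : IntegerRing p K)).map (Ideal.Quotient.mk I)
    have : IsHausdorff 𝔞 (MvPowerSeries (Fin n) (IntegerRing p K) ⧸ I) := by
      refine (IsHausdorff.map_algebraMap_iff
        (S := MvPowerSeries (Fin n) (IntegerRing p K) ⧸ I)).2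
        (IsHausdorff.of_le_jacobson _ _ (augIdeal_le_jacobson (p : IntegerRing p K)))
    have key : (Ideal.Quotient.mk I) = (Ideal.Quotient.mk I).comp (partialEval T hz) := by
      refine ringHom_ext_of_isHausdorff 𝔞 (fun a ↦ by simp) (fun i ↦ ?_) fun i ↦
        ⟨1, by rw [pow_one]; exact Ideal.mem_map_of_mem _ (X_mem_augIdeal _ i)⟩
      rw [RingHom.comp_apply, partialEval_X]
      split_ifs with h
      · exact Ideal.Quotient.eq.2 (Ideal.subset_span ⟨i, h, rfl⟩)
      · rfl
    intro f hf
    rw [← Ideal.Quotient.eq_zero_iff_mem, key, RingHom.comp_apply, RingHom.mem_ker.1 hf, map_zero]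
  · rw [hI, Ideal.span_le]
    rintro _ ⟨i, hi, rfl⟩
    simp [partialEval_X, hi]

theorem sliceIdeal_eq_comap_ker : sliceIdeal p K T z =
    (RingHom.ker (partialEval T hz)).comap (MvPowerSeries.map (integerRingMap p K)) := by
  rw [ker_partialEval, sliceIdeal]

theorem mem_sliceIdeal_iff (f : MvPowerSeries (Fin n) (IntegerRing p F)) :
    f ∈ sliceIdeal p K T z ↔ partialEval T hz (MvPowerSeries.map (integerRingMap p K) f) = 0 := by
  rw [sliceIdeal_eq_comap_ker T hz]
  rfl

include hz in
theorem isPrime_sliceIdeal : (sliceIdeal p K T z).IsPrime := by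
  rw [sliceIdeal_eq_comap_ker T hz]
  have : IsDomain (MvPowerSeries (Fin n) (IntegerRing p K)) := NoZeroDivisors.to_isDomain _
  have := RingHom.ker_isPrime (partialEval T hz)
  exact Ideal.comap_isPrime _ _

omit [Algebra ℚ_[p] F] [IsScalarTower ℤ_[p] ℚ_[p] F] [FiniteDimensional ℚ_[p] F]
  [FiniteDimensional F K] in
theorem sliceIdeal_mono {T T' : Set (Fin n)} (h : T ⊆ T') :
    sliceIdeal p K T z ≤ sliceIdeal p K T' z :=
  Ideal.comap_mono (Ideal.span_mono (Set.image_mono h))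

end Partial

variable (K : IntermediateField F (AlgebraicClosure F)) [FiniteDimensional F K]

/-- Evaluation of power series over `𝓞_K` at a torsion point. -/
noncomputable def evalOver (w : TorsionPoint p F n) :
    MvPowerSeries (Fin n) (IntegerRing p K) →+* ClosureRing p F :=
  (exists_ringHom_X_eq_val (RingHom.id (IntegerRing p K)) w).choose

@[simp]
theorem evalOver_C (w : TorsionPoint p F n) (c : IntegerRing p K) :
    evalOver K w (C c) = inclusionMap p K c :=
  (exists_ringHom_X_eq_val (RingHom.id (IntegerRing p K)) w).choose_spec.1 c

@[simp]
theorem evalOver_X (w : TorsionPoint p F n) (i : Fin n) : evalOver K w (X i) = val (w i) - 1 :=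
  (exists_ringHom_X_eq_val (RingHom.id (IntegerRing p K)) w).choose_spec.2 i

/-- Evaluation of power series over `𝓞_F` at a torsion point. -/
noncomputable def evalAt (w : TorsionPoint p F n) :
    MvPowerSeries (Fin n) (IntegerRing p F) →+* ClosureRing p F :=
  (exists_ringHom_X_eq_val (integerRingMap p ⊥) w).choose

@[simp]
theorem evalAt_C (w : TorsionPoint p F n) (c : IntegerRing p F) :
    evalAt w (C c) = baseMap p F c :=
  (exists_ringHom_X_eq_val (integerRingMap p ⊥) w).choose_spec.1 c

@[simp]
theorem evalAt_X (w : TorsionPoint p F n) (i : Fin n) : evalAt w (X i) = val (w i) - 1 :=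
  (exists_ringHom_X_eq_val (integerRingMap p ⊥) w).choose_spec.2 i

theorem eq_evalAt {w : TorsionPoint p F n}
    {φ : MvPowerSeries (Fin n) (IntegerRing p F) →+* ClosureRing p F}
    (hC : ∀ c, φ (C c) = baseMap p F c) (hX : ∀ i, φ (X i) = val (w i) - 1) : φ = evalAt w :=
  ringHom_ext_of_X_eq_val (fun a ↦ by rw [hC, evalAt_C]) hX (evalAt_X w)

theorem eq_evalOver {w : TorsionPoint p F n}
    {φ : MvPowerSeries (Fin n) (IntegerRing p K) →+* ClosureRing p F}
    (hC : ∀ c, φ (C c) = inclusionMap p K c) (hX : ∀ i, φ (X i) = val (w i) - 1) :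
    φ = evalOver K w :=
  ringHom_ext_of_X_eq_val (fun a ↦ by rw [hC, evalOver_C]) hX (evalOver_X K w)

theorem evalOver_map_integerRingMap (w : TorsionPoint p F n)
    (f : MvPowerSeries (Fin n) (IntegerRing p F)) :
    evalOver K w (MvPowerSeries.map (integerRingMap p K) f) = evalAt w f :=
  DFunLike.congr_fun (eq_evalAt (φ := (evalOver K w).comp (MvPowerSeries.map (integerRingMap p K)))
    (fun c ↦ by simp) (fun i ↦ by simp)) f

theorem evalOver_map_leMap {K L : IntermediateField F (AlgebraicClosure F)}
    [FiniteDimensional F K] [FiniteDimensional F L] (h : K ≤ L) (w : TorsionPoint p F n)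
    (f : MvPowerSeries (Fin n) (IntegerRing p K)) :
    evalOver L w (MvPowerSeries.map (leMap p h) f) = evalOver K w f :=
  DFunLike.congr_fun (eq_evalOver K (φ := (evalOver L w).comp (MvPowerSeries.map (leMap p h)))
    (fun c ↦ by simp) (fun i ↦ by simp)) f

variable {K}

open Classical in
theorem evalOver_partialEval (T : Set (Fin n)) {z : Fin n → IntegerRing p K}
    (hz : ∀ i, ∃ k : ℕ, z i ^ p ^ k = 1) {v w : TorsionPoint p F n}
    (hv : ∀ i, val (v i) = if i ∈ T then inclusionMap p K (z i) else val (w i))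
    (f : MvPowerSeries (Fin n) (IntegerRing p K)) :
    evalOver K w (partialEval T hz f) = evalOver K v f := by
  refine DFunLike.congr_fun (eq_evalOver K (φ := (evalOver K w).comp (partialEval T hz))
    (fun c ↦ by simp) (fun i ↦ ?_)) f
  rw [RingHom.comp_apply, partialEval_X, hv]
  split_ifs <;> simp

theorem sliceIdeal_le_ker_evalAt {T : Set (Fin n)} {z : Fin n → IntegerRing p K}
    (hz : ∀ i, ∃ k : ℕ, z i ^ p ^ k = 1) {w : TorsionPoint p F n}
    (hw : ∀ i ∈ T, inclusionMap p K (z i) = val (w i)) :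
    sliceIdeal p K T z ≤ RingHom.ker (evalAt w) := by
  classical
  intro f hf
  rw [mem_sliceIdeal_iff T hz] at hf
  rw [RingHom.mem_ker, ← evalOver_map_integerRingMap K,
    ← evalOver_partialEval T hz (w := w) (v := w),
    hf, map_zero]
  intro i
  split_ifs with h
  · exact (hw i h).symm
  · rfl

theorem exists_pow_partialEval_X_mem (T : Set (Fin n)) {z : Fin n → IntegerRing p K}
    (hz : ∀ i, ∃ k : ℕ, z i ^ p ^ k = 1) (i : Fin n) :
    ∃ N, partialEval T hz (X i) ^ N ∈ augIdeal n (p : IntegerRing p K) := by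
  classical
  rw [partialEval_X]
  split_ifs
  · obtain ⟨k, hk⟩ := hz i
    refine ⟨p ^ k, ?_⟩
    rw [← map_pow]
    obtain ⟨c, hc⟩ := natCast_dvd_sub_one_pow (Fact.out : p.Prime) hk
    rw [hc, map_mul]
    exact Ideal.mul_mem_right _ _ (C_mem_augIdeal _)
  · exact ⟨1, by rw [pow_one]; exact X_mem_augIdeal _ i⟩

theorem partialEval_univ_eq_zero_iff {z : Fin n → IntegerRing p K}
    (hz : ∀ i, ∃ k : ℕ, z i ^ p ^ k = 1) {w : TorsionPoint p F n}
    (hw : ∀ i, inclusionMap p K (z i) = val (w i)) (f : MvPowerSeries (Fin n) (IntegerRing p K)) :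
    partialEval Set.univ hz f = 0 ↔ evalOver K w f = 0 := by
  have h1 : partialEval Set.univ hz = (C.comp constantCoeff).comp (partialEval Set.univ hz) :=
    ringHom_ext_of_isHausdorff (augIdeal n (p : IntegerRing p K)) (fun c ↦ by simp)
      (fun i ↦ by simp [partialEval_X]) (exists_pow_partialEval_X_mem _ hz)
  have h2 : (inclusionMap p K).comp (constantCoeff.comp (partialEval Set.univ hz)) =
      evalOver K w := eq_evalOver K (fun c ↦ by simp) fun i ↦ by simp [partialEval_X, hw]
  rw [h1, ← h2]
  simp only [RingHom.comp_apply]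
  rw [map_eq_zero_iff _ (inclusionMap_injective p K), map_eq_zero_iff _ C_injective]

theorem sliceIdeal_univ_eq_ker_evalAt {z : Fin n → IntegerRing p K}
    (hz : ∀ i, ∃ k : ℕ, z i ^ p ^ k = 1) {w : TorsionPoint p F n}
    (hw : ∀ i, inclusionMap p K (z i) = val (w i)) :
    sliceIdeal p K Set.univ z = RingHom.ker (evalAt w) := by
  ext f
  rw [mem_sliceIdeal_iff _ hz, partialEval_univ_eq_zero_iff hz hw, evalOver_map_integerRingMap K,
    RingHom.mem_ker]

end Evaluation
end FormalTorus

namespace FormalTorus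

open MvPowerSeries

/-! ### Zariski density of torsion points in slices. -/

section Density

variable {p : ℕ} [Fact p.Prime] {F : Type*} [Field F] [Algebra ℤ_[p] F] {n : ℕ}
  [Algebra ℚ_[p] F] [IsScalarTower ℤ_[p] ℚ_[p] F]

omit [IsScalarTower ℤ_[p] ℚ_[p] F] in
variable (p F) in
theorem exists_isPrimitiveRoot (k : ℕ) : ∃ u : torsionGroup p F, IsPrimitiveRoot u (p ^ k) := by
  have := charZero_of_injective_algebraMap (algebraMap ℚ_[p] (AlgebraicClosure F)).injective
  have : NeZero (p ^ k) := ⟨pow_ne_zero _ (Fact.out : p.Prime).ne_zero⟩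
  obtain ⟨ζ, hζ⟩ := HasEnoughRootsOfUnity.exists_primitiveRoot (AlgebraicClosure F) (p ^ k)
  have hint : IsIntegral ℤ_[p] ζ := hζ.isIntegral (NeZero.pos _) |>.tower_top
  obtain ⟨u, hu, -⟩ := exists_val_eq (p := p) (F := F) (x := ⟨ζ, hint⟩) (k := k)
    (Subtype.ext hζ.pow_eq_one)
  refine ⟨u, ?_⟩
  have h1 : IsPrimitiveRoot (((integralClosure ℤ_[p] (AlgebraicClosure F)).val.toMonoidHom.comp
      val) u) (p ^ k) := by
    simpa [hu] using hζ
  exact h1.of_map_of_injective (Subtype.val_injective.comp val_injective)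

variable [FiniteDimensional ℚ_[p] F]

/-- As for roots of a polynomial: substituting `X i = ζ - 1` in the factorisation found so far kills
the cofactor, because the other linear factors become nonzero constants `ζ - ξ` in a domain. -/
theorem prod_dvd_of_forall_partialEval_eq_zero {K : IntermediateField F (AlgebraicClosure F)}
    [FiniteDimensional F K] (i : Fin n) (g : MvPowerSeries (Fin n) (IntegerRing p K))
    (hg : ∀ (ζ : IntegerRing p K) (hζ : ∀ _ : Fin n, ∃ k : ℕ, ζ ^ p ^ k = 1),
      partialEval {i} hζ g = 0) (s : Finset (IntegerRing p K))
    (hs : ∀ ζ ∈ s, ∃ k : ℕ, ζ ^ p ^ k = 1) : ∏ ζ ∈ s, (X i + 1 - C ζ) ∣ g := by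
  classical
  induction s using Finset.induction_on with
  | empty => simp
  | insert ζ s hζs ih =>
    obtain ⟨u, hu⟩ := ih fun ξ hξ ↦ hs ξ (Finset.mem_insert_of_mem hξ)
    have hζ : ∀ _ : Fin n, ∃ k : ℕ, ζ ^ p ^ k = 1 := fun _ ↦ hs ζ (Finset.mem_insert_self _ _)
    have h1 := hg ζ hζ
    have : NoZeroDivisors (MvPowerSeries (Fin n) (IntegerRing p K)) := inferInstance
    rw [hu, map_mul, map_prod, mul_eq_zero, Finset.prod_eq_zero_iff] at h1
    rcases h1 with ⟨ξ, hξ, h1⟩ | h1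
    · rw [map_sub, map_add, partialEval_X, partialEval_C, if_pos (Set.mem_singleton i), map_one,
        map_sub, map_one, sub_add_cancel, sub_eq_zero] at h1
      exact absurd (C_injective h1 ▸ hξ) hζs
    · rw [← RingHom.mem_ker, ker_partialEval, Set.image_singleton, Ideal.mem_span_singleton] at h1
      obtain ⟨v, rfl⟩ := h1
      rw [Finset.prod_insert hζs, hu]
      exact ⟨v, by rw [map_sub, map_one]; ring⟩

/-- The series is divisible by `(1 + X i) ^ p ^ N - 1` for every `N`, hence lies in arbitrarily high
powers of `(p, X)` after extension of scalars. -/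
theorem eq_zero_of_forall_partialEval_singleton {K : IntermediateField F (AlgebraicClosure F)}
    [FiniteDimensional F K] (i : Fin n) (g : MvPowerSeries (Fin n) (IntegerRing p K))
    (hg : ∀ (L : IntermediateField F (AlgebraicClosure F)) (_ : FiniteDimensional F L) (h : K ≤ L)
      (ζ : IntegerRing p L) (hζ : ∀ _ : Fin n, ∃ k : ℕ, ζ ^ p ^ k = 1),
      partialEval {i} hζ (MvPowerSeries.map (leMap p h) g) = 0) : g = 0 := by
  refine MvPowerSeries.ext fun e ↦ inclusionMap_injective p K ?_
  rw [coeff_zero, map_zero]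
  refine eq_zero_of_forall_pow_dvd (π := (p : ClosureRing p F)) fun k ↦ ?_
  -- The degree of `e` is added because membership in the `M`-th power gives divisibility by `p ^ (M
  -- - e.degree)` only.
  obtain ⟨u, hu⟩ := exists_isPrimitiveRoot p F (k + e.degree)
  obtain ⟨L, _, h, z, hz⟩ := exists_finiteDimensional_inclusionMap_eq p K fun _ : Unit ↦ val u
  have hprim : IsPrimitiveRoot (z ()) (p ^ (k + e.degree)) := by
    refine IsPrimitiveRoot.of_map_of_injective (f := inclusionMap p L) ?_
      (inclusionMap_injective p L)
    rw [hz]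
    exact hu.map_of_injective val_injective
  have hpos : 0 < p ^ (k + e.degree) := pow_pos (Fact.out : p.Prime).pos _
  have hdvd := prod_dvd_of_forall_partialEval_eq_zero i _ (fun ζ hζ ↦ hg L _ h ζ hζ)
    (Polynomial.nthRootsFinset (p ^ (k + e.degree)) 1) fun ζ hζ ↦
      ⟨_, (Polynomial.mem_nthRootsFinset hpos 1).1 hζ⟩
  have hprod : ∏ ζ ∈ Polynomial.nthRootsFinset (p ^ (k + e.degree)) (1 : IntegerRing p L),
      (X i + 1 - C ζ : MvPowerSeries (Fin n) (IntegerRing p L)) =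
        (1 + X i) ^ p ^ (k + e.degree) - 1 := by
    have := congrArg (Polynomial.eval₂ (C : _ →+* MvPowerSeries (Fin n) (IntegerRing p L))
      (1 + X i)) (Polynomial.X_pow_sub_one_eq_prod hpos hprim)
    simp only [Polynomial.eval₂_finsetProd, Polynomial.eval₂_sub, Polynomial.eval₂_pow,
      Polynomial.eval₂_X,
      Polynomial.eval₂_one, Polynomial.eval₂_C] at this
    rw [this]
    exact Finset.prod_congr rfl fun _ _ ↦ by rw [add_comm]
  have hmem : MvPowerSeries.map (leMap p h) g ∈
      augIdeal n (p : IntegerRing p L) ^ (k + e.degree + 1) := by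
    refine Ideal.mem_of_dvd _ (hprod ▸ hdvd) (one_add_pow_prime_pow_sub_one_mem ?_
      (X_mem_augIdeal _ i) _)
    simpa using C_mem_augIdeal (n := n) (p : IntegerRing p L)
  have := map_dvd (inclusionMap p L) (augIdeal_pow_le _ _ hmem e)
  rw [coeff_map, inclusionMap_leMap, map_pow, map_natCast] at this
  exact (pow_dvd_pow _ (by omega)).trans this

theorem partialEval_singleton_map_partialEval {K L : IntermediateField F (AlgebraicClosure F)}
    [FiniteDimensional F K] [FiniteDimensional F L] (h : K ≤ L) {T : Set (Fin n)} {i : Fin n}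
    (hi : i ∉ T) {z : Fin n → IntegerRing p K} (hz : ∀ i, ∃ k : ℕ, z i ^ p ^ k = 1)
    {ζ : IntegerRing p L} (hζ : ∀ _ : Fin n, ∃ k : ℕ, ζ ^ p ^ k = 1) {z' : Fin n → IntegerRing p L}
    (hz' : ∀ i, ∃ k : ℕ, z' i ^ p ^ k = 1) (hzi : z' i = ζ) (hzT : ∀ j ∈ T, z' j = leMap p h (z j))
    (g : MvPowerSeries (Fin n) (IntegerRing p K)) :
    partialEval {i} hζ (MvPowerSeries.map (leMap p h) (partialEval T hz g)) =
      partialEval (insert i T) hz' (MvPowerSeries.map (leMap p h) g) := by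
  refine (DFunLike.congr_fun (f := (partialEval (insert i T) hz').comp
    (MvPowerSeries.map (leMap p h))) (g := (partialEval {i} hζ).comp
    ((MvPowerSeries.map (leMap p h)).comp (partialEval T hz))) ?_ g).symm
  refine ringHom_ext_of_isHausdorff (augIdeal n (p : IntegerRing p L)) (fun c ↦ by simp)
    (fun j ↦ ?_) fun j ↦ ?_
  · simp only [RingHom.comp_apply, map_X]
    rw [partialEval_X, partialEval_X]
    by_cases hj : j ∈ T
    · rw [if_pos (Set.mem_insert_of_mem _ hj), if_pos hj, map_C, partialEval_C, hzT j hj,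
          map_sub (leMap p h),
        map_one (leMap p h)]
    · rw [if_neg hj, map_X, partialEval_X]
      by_cases hji : j = i
      · subst hji
        simp [hzi]
      · simp [hji, hj]
  · simpa using exists_pow_partialEval_X_mem (insert i T) hz' j

theorem eq_zero_of_forall_partialEval (T : Finset (Fin n))
    (K : IntermediateField F (AlgebraicClosure F)) [FiniteDimensional F K]
    (g : MvPowerSeries (Fin n) (IntegerRing p K))
    (hg : ∀ (L : IntermediateField F (AlgebraicClosure F)) (_ : FiniteDimensional F L) (h : K ≤ L)
      (z : Fin n → IntegerRing p L) (hz : ∀ i, ∃ k : ℕ, z i ^ p ^ k = 1),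
      partialEval T hz (MvPowerSeries.map (leMap p h) g) = 0) : g = 0 := by
  classical
  induction T using Finset.induction_on generalizing K with
  | empty =>
    have h1 := hg K inferInstance le_rfl (fun _ ↦ 1) (fun _ ↦ ⟨0, one_pow _⟩)
    have h2 : leMap p (le_refl K) = RingHom.id _ := rfl
    have h3 : partialEval ((∅ : Finset (Fin n)) : Set (Fin n)) (z := fun _ ↦ (1 : IntegerRing p K))
        (fun _ ↦ ⟨0, one_pow _⟩) = RingHom.id _ :=
      ringHom_ext_of_isHausdorff (augIdeal n (p : IntegerRing p K)) (fun c ↦ by simp)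
        (fun j ↦ by simp [partialEval_X]) (exists_pow_partialEval_X_mem _ _)
    rw [h2, h3] at h1
    simpa using h1
  | insert i T hi ih =>
    refine ih K g fun L _ h z hz ↦ ?_
    refine eq_zero_of_forall_partialEval_singleton i _ fun L' _ h' ζ hζ ↦ ?_
    have hz' : ∀ j, ∃ k : ℕ, Function.update (fun j ↦ leMap p h' (z j)) i ζ j ^ p ^ k = 1 := by
      intro j
      by_cases hj : j = i
      · subst hj
        simpa using hζ j
      · obtain ⟨k, hk⟩ := hz j
        exact ⟨k, by rw [Function.update_of_ne hj, ← map_pow, hk, map_one]⟩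
    rw [partialEval_singleton_map_partialEval h' (by simpa using hi) hz hζ hz' (by simp)
      fun j hj ↦ Function.update_of_ne (by rintro rfl; exact hi hj) _ _, ← Finset.coe_insert]
    have := hg L' inferInstance (h.trans h') _ hz'
    exact this

theorem eq_zero_of_forall_evalOver {K : IntermediateField F (AlgebraicClosure F)}
    [FiniteDimensional F K] {g : MvPowerSeries (Fin n) (IntegerRing p K)}
    (hg : ∀ w, evalOver K w g = 0) : g = 0 := by
  refine eq_zero_of_forall_partialEval Finset.univ K g fun L _ h z hz ↦ ?_
  obtain ⟨w, hw⟩ := exists_torsionPoint_of_pow_eq_one L hz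
  rw [Finset.coe_univ, partialEval_univ_eq_zero_iff hz hw, evalOver_map_leMap, hg]

/-- Density inside a slice: after substituting `z` on `T`, every evaluation of the resulting series
is an evaluation of `f` at a point of the slice, so density for the full ring applies. -/
theorem mem_sliceIdeal_of_forall_evalAt {K : IntermediateField F (AlgebraicClosure F)}
    [FiniteDimensional F K] {T : Set (Fin n)} {z : Fin n → IntegerRing p K}
    (hz : ∀ i, ∃ k : ℕ, z i ^ p ^ k = 1) {f : MvPowerSeries (Fin n) (IntegerRing p F)}
    (hf : ∀ w : TorsionPoint p F n, (∀ i ∈ T, inclusionMap p K (z i) = val (w i)) →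
      evalAt w f = 0) : f ∈ sliceIdeal p K T z := by
  classical
  rw [mem_sliceIdeal_iff T hz]
  refine eq_zero_of_forall_evalOver fun w ↦ ?_
  obtain ⟨v, hv⟩ := exists_torsionPoint_of_pow_eq_one K hz
  rw [evalOver_partialEval T hz (v := fun i ↦ if i ∈ T then v i else w i),
    evalOver_map_integerRingMap]
  · exact hf _ fun i hi ↦ by rw [if_pos hi, hv]
  · intro i
    split_ifs with h
    · exact (hv i).symm
    · rfl

end Density
end FormalTorus

namespace FormalTorus

/-! ### Galois action on roots of unity. -/

section Galois

open Polynomial in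
theorem isEisensteinAt_cyclotomic_comp (p : ℕ) [Fact p.Prime] (k : ℕ) :
    ((cyclotomic (p ^ (k + 1)) ℤ_[p]).comp (X + 1)).IsEisensteinAt (Ideal.span {(p : ℤ_[p])}) := by
  have hE := cyclotomic_prime_pow_comp_X_add_one_isEisensteinAt p k
  have hmap : (cyclotomic (p ^ (k + 1)) ℤ_[p]).comp (X + 1) =
      ((cyclotomic (p ^ (k + 1)) ℤ).comp (X + 1)).map (Int.castRingHom ℤ_[p]) := by
    simp [Polynomial.map_comp]
  have hmon : ((cyclotomic (p ^ (k + 1)) ℤ).comp (X + 1)).Monic :=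
    (cyclotomic.monic _ _).comp (monic_X_add_C 1) (by
      rw [← C_1, natDegree_X_add_C]
      exact one_ne_zero)
  rw [hmap]
  refine ⟨?_, fun {i} hi ↦ ?_, ?_⟩
  · rw [(hmon.map _).leadingCoeff, ← Ideal.eq_top_iff_one, ← PadicInt.maximalIdeal_eq_span_p]
    exact Ideal.IsPrime.ne_top inferInstance
  · rw [hmon.natDegree_map] at hi
    have := hE.mem hi
    rw [Ideal.submodule_span_eq, Ideal.mem_span_singleton] at this
    rw [coeff_map, Ideal.mem_span_singleton]
    simpa using map_dvd (Int.castRingHom ℤ_[p]) this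
  · have := hE.notMem
    rw [Ideal.submodule_span_eq, Ideal.span_singleton_pow, Ideal.mem_span_singleton] at this
    rw [coeff_map, Ideal.span_singleton_pow, Ideal.mem_span_singleton, eq_intCast,
      PadicInt.pow_p_dvd_int_iff]
    exact_mod_cast this

open Polynomial in
-- The shifted cyclotomic polynomial is Eisenstein at `p`, hence it is the minimal polynomial of `ζ
-- - 1` over `ℚ_p`.
theorem totient_le_finrank (p : ℕ) [Fact p.Prime] {L : Type*} [Field L] [Algebra ℚ_[p] L]
    [FiniteDimensional ℚ_[p] L] {k : ℕ} {ζ : L} (hζ : IsPrimitiveRoot ζ (p ^ (k + 1))) :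
    (p ^ (k + 1)).totient ≤ Module.finrank ℚ_[p] L := by
  set f := (cyclotomic (p ^ (k + 1)) ℤ_[p]).comp (X + 1) with hf
  have hmon : f.Monic :=
    (cyclotomic.monic _ _).comp (monic_X_add_C 1) (by
      rw [← C_1, natDegree_X_add_C]
      exact one_ne_zero)
  have hdeg : f.natDegree = (p ^ (k + 1)).totient := by
    rw [hf, natDegree_comp, natDegree_cyclotomic, ← C_1, natDegree_X_add_C, mul_one]
  have hpos : 0 < f.natDegree := by
    rw [hdeg]
    exact Nat.totient_pos.2 (pow_pos (Fact.out : p.Prime).pos _)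
  have hprime : (Ideal.span {(p : ℤ_[p])}).IsPrime := by
    rw [← PadicInt.maximalIdeal_eq_span_p]
    infer_instance
  have hirr : Irreducible f :=
    (isEisensteinAt_cyclotomic_comp p k).irreducible hprime hmon.isPrimitive hpos
  have hirr' : Irreducible (f.map (algebraMap ℤ_[p] ℚ_[p])) :=
    (hmon.irreducible_iff_irreducible_map_fraction_map (K := ℚ_[p])).1 hirr
  have hroot : aeval (ζ - 1) (f.map (algebraMap ℤ_[p] ℚ_[p])) = 0 := by
    have hchar := charZero_of_injective_algebraMap (algebraMap ℚ_[p] L).injective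
    have : NeZero (((p ^ (k + 1) : ℕ)) : L) :=
      ⟨Nat.cast_ne_zero.2 (pow_ne_zero _ (Fact.out : p.Prime).ne_zero)⟩
    have h1 : f.map (algebraMap ℤ_[p] ℚ_[p]) = (cyclotomic (p ^ (k + 1)) ℚ_[p]).comp (X + 1) := by
      simp [hf, Polynomial.map_comp]
    rw [h1, aeval_comp, map_add, aeval_X, map_one, sub_add_cancel, ← eval_map_algebraMap,
      map_cyclotomic]
    exact hζ.isRoot_cyclotomic (pow_pos (Fact.out : p.Prime).pos _)
  have hmin := minpoly.eq_of_irreducible_of_monic hirr' hroot (hmon.map _)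
  have := minpoly.natDegree_le (A := ℚ_[p]) (ζ - 1)
  rwa [← hmin, hmon.natDegree_map, hdeg] at this

variable {p : ℕ} [Fact p.Prime] {F : Type*} [Field F] [Algebra ℚ_[p] F] [FiniteDimensional ℚ_[p] F]

/-- Counting conjugates of `ζ` shows that the cyclotomic character has image of index at most `D =
[F : ℚ_p]`. The index divides `D!`, so all `D!`-th powers are in the image. The point is that this
exponent does not depend on `k`. -/
theorem exists_algEquiv_eq_pow {k : ℕ} {ζ : AlgebraicClosure F}
    (hζ : IsPrimitiveRoot ζ (p ^ (k + 1))) {a : ℕ} (ha : a.Coprime p) :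
    ∃ σ : AlgebraicClosure F ≃ₐ[F] AlgebraicClosure F,
      σ ζ = ζ ^ a ^ (Module.finrank ℚ_[p] F).factorial := by
  have : NeZero (p ^ (k + 1)) := ⟨pow_ne_zero _ (Fact.out : p.Prime).ne_zero⟩
  have := charZero_of_injective_algebraMap (algebraMap ℚ_[p] F).injective
  set D := Module.finrank ℚ_[p] F with hD
  set χ := hζ.autToPow F with hχ
  have hint : IsIntegral F ζ := Algebra.IsIntegral.isIntegral ζ
  have hcard : (minpoly F ζ).natDegree ≤ Nat.card χ.range := by
    have h1 : Fintype.card ((minpoly F ζ).rootSet (AlgebraicClosure F)) =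
        (minpoly F ζ).natDegree :=
      Polynomial.card_rootSet_eq_natDegree (minpoly.irreducible hint).separable
        (IsAlgClosed.splits _)
    have h2 : ∀ y : (minpoly F ζ).rootSet (AlgebraicClosure F),
        ∃ σ : AlgebraicClosure F ≃ₐ[F] AlgebraicClosure F, σ ζ = y := fun y ↦
      minpoly.exists_algEquiv_of_root' (Algebra.IsAlgebraic.isAlgebraic ζ)
        (Polynomial.aeval_eq_zero_of_mem_rootSet y.2)
    choose σ hσ using h2
    rw [← h1, ← Nat.card_eq_fintype_card]
    refine Nat.card_le_card_of_injective (fun y ↦ (⟨χ (σ y), σ y, rfl⟩ : χ.range)) fun y y' h ↦ ?_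
    have h3 : χ (σ y) = χ (σ y') := congrArg Subtype.val h
    apply Subtype.ext
    rw [← hσ y, ← hσ y', ← hζ.autToPow_spec F (σ y), ← hζ.autToPow_spec F (σ y'), ← hχ, h3]
  have hdeg : (p ^ (k + 1)).totient ≤ D * (minpoly F ζ).natDegree := by
    have : FiniteDimensional F (IntermediateField.adjoin F {ζ}) :=
      IntermediateField.adjoin.finiteDimensional hint
    have : FiniteDimensional ℚ_[p] (IntermediateField.adjoin F {ζ}) :=
      FiniteDimensional.trans ℚ_[p] F _
    have h1 : IsPrimitiveRoot (IntermediateField.AdjoinSimple.gen F ζ) (p ^ (k + 1)) :=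
      IsPrimitiveRoot.of_map_of_injective (f := algebraMap _ (AlgebraicClosure F))
        (by simpa using hζ) (FaithfulSMul.algebraMap_injective _ _)
    rw [hD, ← IntermediateField.adjoin.finrank hint, Module.finrank_mul_finrank]
    exact totient_le_finrank p h1
  have hindex : χ.range.index ≤ D := by
    have h1 := χ.range.card_mul_index
    rw [Nat.card_eq_fintype_card (α := (ZMod (p ^ (k + 1)))ˣ), ZMod.card_units_eq_totient] at h1
    have h2 : 0 < Nat.card χ.range := Nat.card_pos
    refine Nat.le_of_mul_le_mul_left ?_ h2
    rw [h1, mul_comm]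
    exact hdeg.trans (Nat.mul_le_mul_left _ hcard)
  have hdvd : χ.range.index ∣ D.factorial :=
    Nat.dvd_factorial (Nat.pos_of_ne_zero Subgroup.FiniteIndex.index_ne_zero) hindex
  let u : (ZMod (p ^ (k + 1)))ˣ := ZMod.unitOfCoprime a (ha.pow_right _)
  have hu : u ^ D.factorial ∈ χ.range := by
    obtain ⟨c, hc⟩ := hdvd
    rw [hc, pow_mul]
    exact pow_mem (Subgroup.pow_index_mem _ u) c
  obtain ⟨σ, hσ⟩ := hu
  refine ⟨σ, ?_⟩
  have h3 : ((u ^ D.factorial : (ZMod (p ^ (k + 1)))ˣ) : ZMod (p ^ (k + 1))) =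
      ((a ^ D.factorial : ℕ) : ZMod (p ^ (k + 1))) := by
    simp [u]
  rw [← hζ.autToPow_spec F σ, ← hχ, hσ, h3, ZMod.val_natCast, ← pow_eq_pow_mod _ hζ.pow_eq_one]

variable [Algebra ℤ_[p] F]

/-- The action of a Galois automorphism on the integers of the algebraic closure. -/
noncomputable def galoisMap (σ : AlgebraicClosure F ≃ₐ[F] AlgebraicClosure F) :
    ClosureRing p F →+* ClosureRing p F :=
  ((σ.toAlgHom.restrictScalars ℤ_[p]).mapIntegralClosure : ClosureRing p F →ₐ[ℤ_[p]] _)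

open MvPowerSeries

variable [IsScalarTower ℤ_[p] ℚ_[p] F] {n : ℕ}

theorem evalAt_eq_zero_of_galois {w v : TorsionPoint p F n}
    (σ : AlgebraicClosure F ≃ₐ[F] AlgebraicClosure F)
    (h : ∀ i, galoisMap σ (val (w i)) = val (v i))
    {f : MvPowerSeries (Fin n) (IntegerRing p F)} (hf : evalAt w f = 0) : evalAt v f = 0 := by
  rw [← eq_evalAt (φ := (galoisMap σ).comp (evalAt w)) (fun c ↦ ?_) (fun i ↦ ?_),
    RingHom.comp_apply, hf, map_zero]
  · rw [RingHom.comp_apply, evalAt_C]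
    exact Subtype.ext (σ.commutes _)
  · rw [RingHom.comp_apply, evalAt_X, map_sub, h, map_one]

theorem evalAt_pow_eq_zero {w : TorsionPoint p F n} {m : ℕ} (hw : ∀ i, w i ^ p ^ m = 1) {a : ℕ}
    (ha : a.Coprime p) {f : MvPowerSeries (Fin n) (IntegerRing p F)} (hf : evalAt w f = 0) :
    evalAt (w ^ a ^ (Module.finrank ℚ_[p] F).factorial) f = 0 := by
  -- The level `m + 1` has the form required by `exists_algEquiv_eq_pow` even when `m = 0`.
  obtain ⟨u, hu⟩ := exists_isPrimitiveRoot p F (m + 1)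
  have hu' : IsPrimitiveRoot (val u : AlgebraicClosure F) (p ^ (m + 1)) :=
    hu.map_of_injective (f := ((integralClosure ℤ_[p] (AlgebraicClosure F)).val.toMonoidHom.comp
      val)) (Subtype.val_injective.comp val_injective)
  obtain ⟨σ, hσ⟩ := exists_algEquiv_eq_pow hu' ha
  have hσ' : galoisMap σ (val u) = val u ^ a ^ (Module.finrank ℚ_[p] F).factorial :=
    Subtype.ext hσ
  refine evalAt_eq_zero_of_galois σ (fun i ↦ ?_) hf
  have : NeZero (p ^ (m + 1)) := ⟨pow_ne_zero _ (Fact.out : p.Prime).ne_zero⟩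
  have h1 : (w i : (ClosureRing p F)ˣ) ^ p ^ (m + 1) = 1 := by
    rw [pow_succ, pow_mul]
    have := congrArg (Subtype.val) (hw i)
    rw [Subgroup.coe_pow, Subgroup.coe_one] at this
    rw [this, one_pow]
  obtain ⟨j, -, hj⟩ := (hu.map_of_injective (f := val) val_injective).eq_pow_of_pow_eq_one
    (ξ := val (w i)) (by rw [← map_pow, pow_succ, pow_mul, hw, one_pow, map_one])
  rw [Pi.pow_apply, map_pow, ← hj, map_pow, hσ', ← pow_mul, ← pow_mul, mul_comm]

end Galois
end FormalTorus

namespace FormalTorus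

open MvPowerSeries

/-! ### Orbits under translation by a torsion point, described over the base. -/

section Translation

variable {p : ℕ} [Fact p.Prime] {F : Type*} [Field F] [Algebra ℚ_[p] F] [Algebra ℤ_[p] F]
  [IsScalarTower ℤ_[p] ℚ_[p] F] [FiniteDimensional ℚ_[p] F] {n : ℕ}

/-- Translate by a generic root `y` over `𝓞_F[y] / (y ^ p ^ k - 1)` and expand in powers of `y`; the
coefficients are series over `𝓞_F`. -/
theorem exists_evalAt_mul_pow_eq_sum {k : ℕ} {u : torsionGroup p F} (hu : u ^ p ^ k = 1)
    (e : Fin n → ℕ) (f : MvPowerSeries (Fin n) (IntegerRing p F)) :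
    ∃ c : Fin (p ^ k) → MvPowerSeries (Fin n) (IntegerRing p F), ∀ (w : TorsionPoint p F n) (t : ℕ),
      evalAt (fun i ↦ w i * (u ^ e i) ^ t) f =
        ∑ j : Fin (p ^ k), (val u ^ t) ^ (j : ℕ) * evalAt w (c j) := by
  have hN : 0 < p ^ k := pow_pos (Fact.out : p.Prime).pos _
  -- The full polynomial, not a cyclotomic factor, so that `y` can specialise to `u ^ t` for every
  -- `t`.
  let q : Polynomial (IntegerRing p F) := Polynomial.X ^ p ^ k - 1
  have hq : q.Monic := Polynomial.monic_X_pow_sub_C 1 hN.ne'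
  have hqd : q.natDegree = p ^ k := Polynomial.natDegree_X_pow_sub_C (r := 1)
  let y : AdjoinRoot q := AdjoinRoot.root q
  have hy : y ^ p ^ k = 1 := by
    have := AdjoinRoot.eval₂_root q
    simpa [q, sub_eq_zero] using this
  have := integerRing_finite p F
  have := integerRing_free p F
  have := hq.finite_adjoinRoot
  have := hq.free_adjoinRoot
  have : Module.Finite ℤ_[p] (AdjoinRoot q) := Module.Finite.trans (IntegerRing p F) _
  have : Module.Free ℤ_[p] (AdjoinRoot q) := Module.Free.trans (S := IntegerRing p F)
  have := isAdicComplete_span_natCast p (AdjoinRoot q)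
  obtain ⟨Φ, hΦC, hΦX⟩ := exists_ringHom_X_eq (n := n) (p : AdjoinRoot q) (AdjoinRoot.of q)
    (fun i : Fin n ↦ (1 + X i) * C (y ^ e i) - 1) fun i ↦ ⟨p ^ k, by
      simpa using natCast_dvd_sub_one_pow (Fact.out : p.Prime) (u := y ^ e i) (k := k)
        (by rw [← pow_mul, mul_comm, pow_mul, hy, one_pow])⟩
  let b := AdjoinRoot.powerBasis' hq
  have hbd : b.dim = p ^ k := hqd
  let c : Fin b.dim → MvPowerSeries (Fin n) (IntegerRing p F) :=
    fun j d ↦ b.basis.repr (coeff d (Φ f)) j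
  have hc : ∀ j d, coeff d (c j) = b.basis.repr (coeff d (Φ f)) j := fun _ _ ↦ rfl
  have hsum : Φ f =
      ∑ j : Fin b.dim, C (y ^ (j : ℕ)) * MvPowerSeries.map (AdjoinRoot.of q) (c j) := by
    ext d
    rw [map_sum]
    conv_lhs => rw [← b.basis.sum_repr (coeff d (Φ f))]
    refine Finset.sum_congr rfl fun j _ ↦ ?_
    rw [coeff_C_mul, coeff_map, hc, b.basis_eq_pow, mul_comm, Algebra.smul_def]
    rfl
  suffices h : ∀ (w : TorsionPoint p F n) (t : ℕ), evalAt (fun i ↦ w i * (u ^ e i) ^ t) f =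
      ∑ j : Fin b.dim, (val u ^ t) ^ (j : ℕ) * evalAt w (c j) by
    refine ⟨fun j ↦ c (Fin.cast hbd.symm j), fun w t ↦ (h w t).trans ?_⟩
    exact (Fintype.sum_equiv (finCongr hbd.symm) _ _ fun j ↦ rfl).symm
  intro w t
  obtain ⟨K, _, -, z, hz⟩ := exists_finiteDimensional_inclusionMap_eq p
    (⊥ : IntermediateField F (AlgebraicClosure F)) fun _ : Unit ↦ val u
  have hzN : z () ^ p ^ k = 1 :=
    inclusionMap_injective p K (by rw [map_pow, hz, ← map_pow, hu, map_one, map_one])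
  let θ : AdjoinRoot q →+* IntegerRing p K := AdjoinRoot.lift (integerRingMap p K) (z () ^ t) (by
    simp [q, ← pow_mul, mul_comm t, pow_mul _ (p ^ k) t, hzN])
  obtain ⟨ψ, hψC, hψX⟩ := exists_ringHom_X_eq_val θ w
  have hθ : inclusionMap p K (θ y) = val u ^ t := by
    rw [AdjoinRoot.lift_root, map_pow, hz]
  have h1 : ψ.comp Φ = evalAt (fun i ↦ w i * (u ^ e i) ^ t) := by
    refine eq_evalAt (fun c ↦ ?_) fun i ↦ ?_
    · rw [RingHom.comp_apply, hΦC, hψC, AdjoinRoot.lift_of, inclusionMap_integerRingMap]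
    · rw [RingHom.comp_apply, hΦX, map_sub, map_mul, map_add, map_one, hψX, hψC, map_pow, map_pow,
        hθ, map_mul, map_pow, map_pow, ← pow_mul, ← pow_mul, mul_comm t, add_sub_cancel]
  have h2 : ∀ g, ψ (MvPowerSeries.map (AdjoinRoot.of q) g) = evalAt w g := fun g ↦
    DFunLike.congr_fun (eq_evalAt (φ := ψ.comp (MvPowerSeries.map (AdjoinRoot.of q)))
      (fun c ↦ by
        rw [RingHom.comp_apply, map_C, hψC, AdjoinRoot.lift_of, inclusionMap_integerRingMap])
      (fun i ↦ by rw [RingHom.comp_apply, map_X, hψX])) g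
  rw [← h1, RingHom.comp_apply, hsum, map_sum]
  refine Finset.sum_congr rfl fun j _ ↦ ?_
  rw [map_mul, h2, hψC, map_pow, map_pow, hθ]

/-- A single translate of `f` has coefficients outside `𝓞_F`, but the condition on the whole orbit
does not need them: the values on the orbit are Vandermonde combinations, with distinct nodes, of
the values of the `c j`. -/
theorem exists_forall_evalAt_mul_pow_eq_zero_iff {k : ℕ} {η : TorsionPoint p F n}
    (hη : η ^ p ^ k = 1) (f : MvPowerSeries (Fin n) (IntegerRing p F)) :
    ∃ c : Fin (p ^ k) → MvPowerSeries (Fin n) (IntegerRing p F), ∀ w : TorsionPoint p F n,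
      (∀ t : ℕ, evalAt (w * η ^ t) f = 0) ↔ ∀ j, evalAt w (c j) = 0 := by
  have : NeZero (p ^ k) := ⟨pow_ne_zero _ (Fact.out : p.Prime).ne_zero⟩
  obtain ⟨u, hu⟩ := exists_isPrimitiveRoot p F k
  have huv := hu.map_of_injective (f := val) val_injective
  have he : ∀ i, ∃ e : ℕ, u ^ e = η i := fun i ↦ by
    obtain ⟨e, -, he⟩ := huv.eq_pow_of_pow_eq_one (ξ := val (η i))
      (by rw [← map_pow, ← Pi.pow_apply, hη, Pi.one_apply, map_one])
    exact ⟨e, val_injective (by rw [map_pow, he])⟩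
  choose e he using he
  obtain ⟨c, hc⟩ := exists_evalAt_mul_pow_eq_sum hu.pow_eq_one e f
  have hc' : ∀ (w : TorsionPoint p F n) (t : ℕ), evalAt (w * η ^ t) f =
      ∑ j : Fin (p ^ k), (val u ^ t) ^ (j : ℕ) * evalAt w (c j) := fun w t ↦ by
    rw [← hc]
    congr 2
    funext i
    rw [Pi.mul_apply, Pi.pow_apply, he]
  refine ⟨c, fun w ↦ ⟨fun h ↦ ?_, fun h t ↦ ?_⟩⟩
  · have hinj : Function.Injective fun t : Fin (p ^ k) ↦ val u ^ (t : ℕ) := fun t t' htt' ↦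
      Fin.ext (huv.pow_inj t.2 t'.2 htt')
    exact congrFun (Matrix.eq_zero_of_forall_index_sum_pow_mul_eq_zero hinj fun t ↦ by
      rw [← hc', h])
  · rw [hc']
    exact Finset.sum_eq_zero fun j _ ↦ by rw [h, mul_zero]

end Translation
end FormalTorus

namespace FormalTorus

open MvPowerSeries

/-! ### Multiplicative changes of variables and their action on torsion points. -/

section ChangesOfVariables

variable {p : ℕ} [Fact p.Prime] {F : Type*} [Field F] [Algebra ℤ_[p] F] {n : ℕ}

theorem onePlusXPow_eq_substAlgHom (j : Fin n) (b : ℤ_[p]) : onePlusXPow F j b =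
    PowerSeries.substAlgHom (PowerSeries.HasSubst.X j :
      PowerSeries.HasSubst (X j : MvPowerSeries (Fin n) (IntegerRing p F)))
      (PowerSeries.binomialSeries (IntegerRing p F) b) := by
  rw [PowerSeries.coe_substAlgHom, onePlusXPow]

theorem onePlusXPow_add (j : Fin n) (a b : ℤ_[p]) :
    onePlusXPow F j (a + b) = onePlusXPow F j a * onePlusXPow F j b := by
  simp only [onePlusXPow_eq_substAlgHom, PowerSeries.binomialSeries_add, map_mul]

theorem onePlusXPow_natCast (j : Fin n) (N : ℕ) :
    onePlusXPow (p := p) F j (N : ℤ_[p]) = (1 + X j) ^ N := by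
  rw [onePlusXPow_eq_substAlgHom, PowerSeries.binomialSeries_nat, map_pow, map_add, map_one,
    PowerSeries.substAlgHom_X]

theorem onePlusXPow_zero (j : Fin n) : onePlusXPow (p := p) F j 0 = 1 := by
  simpa using onePlusXPow_natCast (p := p) (F := F) j 0

theorem onePlusXPow_natCast_mul (j : Fin n) (N : ℕ) (b : ℤ_[p]) :
    onePlusXPow F j ((N : ℤ_[p]) * b) = onePlusXPow F j b ^ N := by
  induction N with
  | zero => rw [Nat.cast_zero, zero_mul, onePlusXPow_zero, pow_zero]
  | succ N ih => rw [Nat.cast_succ, add_one_mul, onePlusXPow_add, ih, pow_succ]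

theorem X_dvd_onePlusXPow_sub_one (j : Fin n) (b : ℤ_[p]) : X j ∣ onePlusXPow F j b - 1 := by
  have h : (PowerSeries.X : PowerSeries (IntegerRing p F)) ∣
      PowerSeries.binomialSeries (IntegerRing p F) b - 1 := by
    rw [PowerSeries.X_dvd_iff]
    simp
  have := map_dvd (PowerSeries.substAlgHom (PowerSeries.HasSubst.X j :
      PowerSeries.HasSubst (X j : MvPowerSeries (Fin n) (IntegerRing p F)))) h
  rwa [PowerSeries.substAlgHom_X, map_sub, map_one, ← onePlusXPow_eq_substAlgHom] at this

/-- The power `ζ ^ b` of a root of unity of `p`-power order, for `b ∈ ℤ_p`. -/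
noncomputable def zpPow (u : torsionGroup p F) (b : ℤ_[p]) : torsionGroup p F :=
  u ^ b.appr (exists_pow_eq_one u).choose

theorem zpPow_eq {u : torsionGroup p F} {k : ℕ} (hu : u ^ p ^ k = 1) (b : ℤ_[p]) :
    zpPow u b = u ^ b.appr k := by
  have key : ∀ {m l : ℕ}, m ≤ l → u ^ p ^ m = 1 → u ^ b.appr l = u ^ b.appr m := by
    intro m l hml hm
    obtain ⟨c, hc⟩ := b.dvd_appr_sub_appr m l hml
    rw [← Nat.add_sub_cancel' (b.appr_mono hml), hc, pow_add, pow_mul, hm, one_pow, mul_one]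
  rcases le_total k (exists_pow_eq_one u).choose with h | h
  · exact key h hu
  · exact (key h (exists_pow_eq_one u).choose_spec).symm

theorem zpPow_mul (u v : torsionGroup p F) (b : ℤ_[p]) :
    zpPow (u * v) b = zpPow u b * zpPow v b := by
  obtain ⟨k, hk⟩ := exists_forall_pow_eq_one ![u, v]
  have hu : u ^ p ^ k = 1 := hk 0
  have hv : v ^ p ^ k = 1 := hk 1
  rw [zpPow_eq hu, zpPow_eq hv, zpPow_eq (k := k) (by rw [mul_pow, hu, hv, one_mul]), mul_pow]

theorem triangularSubst_C (B : Fin n → Fin n → ℤ_[p]) (c : IntegerRing p F) :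
    triangularSubst F B (C c) = C c := by
  rw [c_eq_algebraMap, AlgHom.commutes]

theorem triangularSubst_X (B : Fin n → Fin n → ℤ_[p]) (i : Fin n) :
    triangularSubst F B (X i) = triangularSeries F B i :=
  substAlgHom_X _ i

theorem swapSubst_C (i j : Fin n) (c : IntegerRing p F) : swapSubst p F i j (C c) = C c := by
  rw [c_eq_algebraMap, AlgHom.commutes]

theorem swapSubst_X (i j k : Fin n) : swapSubst p F i j (X k) = X (Equiv.swap i j k) :=
  substAlgHom_X _ k

/-- The matrix with column `r` given by `b` and zeros elsewhere. -/
noncomputable def columnMatrix (r : Fin n) (b : Fin n → ℤ_[p]) : Fin n → Fin n → ℤ_[p] :=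
  fun i j ↦ if j = r then b i else 0

theorem triangularSeries_columnMatrix (r : Fin n) (b : Fin n → ℤ_[p]) (i : Fin n) :
    triangularSeries F (columnMatrix r b) i =
      if r < i then (1 + X i) * onePlusXPow F r (b i) - 1 else X i := by
  have h : ∀ j, onePlusXPow F j (columnMatrix r b i j) =
      if j = r then onePlusXPow F r (b i) else 1 := fun j ↦ by
    by_cases hj : j = r
    · subst hj
      simp [columnMatrix]
    · simp [columnMatrix, hj, onePlusXPow_zero]
  simp_rw [triangularSeries, h, Finset.prod_ite_eq', Finset.mem_Iio]
  split_ifs <;> ring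

theorem triangularSubst_columnMatrix_onePlusXPow (r : Fin n) (b : Fin n → ℤ_[p]) (c : ℤ_[p]) :
    triangularSubst F (columnMatrix r b) (onePlusXPow F r c) = onePlusXPow F r c := by
  have hs := hasSubst_of_constantCoeff_zero
    (constantCoeff_triangularSeries (F := F) (columnMatrix r b))
  have hX : PowerSeries.HasSubst (X r : MvPowerSeries (Fin n) (IntegerRing p F)) :=
    PowerSeries.HasSubst.X r
  rw [triangularSubst, coe_substAlgHom, onePlusXPow, PowerSeries.subst,
    subst_comp_subst_apply hX.const hs]
  congr 1
  funext
  rw [subst_X hs, triangularSeries_columnMatrix, if_neg (lt_irrefl r)]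

variable [Algebra ℚ_[p] F] [IsScalarTower ℤ_[p] ℚ_[p] F] [FiniteDimensional ℚ_[p] F]

theorem integerRing_isHausdorff :
    IsHausdorff (Ideal.span {(p : IntegerRing p F)}) (IntegerRing p F) :=
  (integerRing_isAdicComplete p F).toIsHausdorff

theorem algHom_eq_id_of_X {φ : MvPowerSeries (Fin n) (IntegerRing p F) →ₐ[IntegerRing p F]
    MvPowerSeries (Fin n) (IntegerRing p F)} (h : ∀ i, φ (X i) = X i) (f) : φ f = f := by
  have := integerRing_isHausdorff (p := p) (F := F)
  refine DFunLike.congr_fun (ringHom_ext_of_isHausdorff (augIdeal n (p : IntegerRing p F))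
    (φ := (φ : MvPowerSeries (Fin n) (IntegerRing p F) →+* _)) (ψ := RingHom.id _)
    (fun c ↦ ?_) h fun i ↦ ⟨1, ?_⟩) f
  · rw [c_eq_algebraMap]
    exact φ.commutes c
  · rw [pow_one]
    exact (h i).symm ▸ X_mem_augIdeal _ i

theorem swapSubst_surjective (i j : Fin n) : Function.Surjective (swapSubst p F i j) := fun f ↦
  ⟨swapSubst p F i j f, algHom_eq_id_of_X (φ := (swapSubst p F i j).comp (swapSubst p F i j))
    (fun k ↦ by rw [AlgHom.comp_apply, swapSubst_X, swapSubst_X, Equiv.swap_apply_self]) f⟩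

/-- With a single column, only `X r` enters the multipliers and it is itself fixed, so the column
`-b` gives an inverse. -/
theorem triangularSubst_columnMatrix_surjective (r : Fin n) (b : Fin n → ℤ_[p]) :
    Function.Surjective (triangularSubst F (columnMatrix r b)) := fun f ↦ by
  refine ⟨triangularSubst F (columnMatrix r (-b)) f, algHom_eq_id_of_X
    (φ := (triangularSubst F (columnMatrix r b)).comp (triangularSubst F (columnMatrix r (-b))))
    (fun k ↦ ?_) f⟩
  rw [AlgHom.comp_apply, triangularSubst_X, triangularSeries_columnMatrix]
  split_ifs with h
  · rw [map_sub, map_mul, map_add, map_one, triangularSubst_columnMatrix_onePlusXPow,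
      triangularSubst_X, triangularSeries_columnMatrix, if_pos h, add_sub_cancel, mul_assoc,
      ← onePlusXPow_add, Pi.neg_apply, add_neg_cancel, onePlusXPow_zero, mul_one,
      add_sub_cancel_left]
  · rw [triangularSubst_X, triangularSeries_columnMatrix, if_neg h]

/-- Approximate `b` by the natural number `b.appr M`, whose contribution is exactly `1`. The rest is
the `p ^ M`-th power of something congruent to `1` modulo `p`, hence `1` modulo `p ^ M`.
Separatedness concludes, without continuity in `b`. -/
theorem evalAt_onePlusXPow_pow_mul {w : TorsionPoint p F n} {j : Fin n} {k : ℕ}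
    (hk : w j ^ p ^ k = 1) (b : ℤ_[p]) : evalAt w (onePlusXPow F j (p ^ k * b)) = 1 := by
  have h1 : ∀ c : ℤ_[p], (p : ClosureRing p F) ∣ evalAt w (onePlusXPow F j (p ^ k * c)) - 1 := by
    intro c
    have hx : (p : ClosureRing p F) ∣ (evalAt w (onePlusXPow F j c) - 1) ^ p ^ k := by
      refine (natCast_dvd_sub_one_pow Fact.out (u := val (w j)) (k := k)
        (by rw [← map_pow, hk, map_one])).trans (pow_dvd_pow_of_dvd ?_ _)
      have h0 := map_dvd (evalAt w) (X_dvd_onePlusXPow_sub_one (F := F) j c)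
      rwa [evalAt_X, map_sub (evalAt w), map_one] at h0
    obtain ⟨r, hr⟩ := exists_add_pow_prime_pow_eq (Fact.out : p.Prime)
      (evalAt w (onePlusXPow F j c) - 1) 1 k
    have h2 := onePlusXPow_natCast_mul (F := F) j (p ^ k) c
    rw [Nat.cast_pow] at h2
    rw [h2, map_pow]
    rw [sub_add_cancel, one_pow] at hr
    rw [hr, add_sub_right_comm, add_sub_cancel_right]
    exact dvd_add hx ⟨(evalAt w (onePlusXPow F j c) - 1) * 1 * r, by ring⟩
  rw [← sub_eq_zero]
  refine eq_zero_of_forall_pow_dvd (π := (p : ClosureRing p F)) fun M ↦ ?_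
  obtain ⟨c, hc⟩ := Ideal.mem_span_singleton.1 (b.appr_spec M)
  have hb : (p : ℤ_[p]) ^ k * b = ((p ^ k * b.appr M : ℕ) : ℤ_[p]) + (p ^ M : ℕ) * (p ^ k * c) := by
    push_cast
    linear_combination (p : ℤ_[p]) ^ k * hc
  have h3 : evalAt w (onePlusXPow (p := p) F j ((p ^ k * b.appr M : ℕ) : ℤ_[p])) = 1 := by
    rw [onePlusXPow_natCast, map_pow, map_add, map_one, evalAt_X, add_sub_cancel, pow_mul,
      ← map_pow, hk, map_one, one_pow]
  rw [hb, onePlusXPow_add, map_mul, h3, one_mul, onePlusXPow_natCast_mul, map_pow]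
  have h4 := one_add_pow_prime_pow_sub_one_mem (p := p)
    (𝔞 := Ideal.span {(p : ClosureRing p F)}) (Ideal.mem_span_singleton_self _)
    (Ideal.mem_span_singleton.2 (h1 c)) M
  rw [add_sub_cancel, Ideal.span_singleton_pow, Ideal.mem_span_singleton] at h4
  exact (pow_dvd_pow _ (Nat.le_succ M)).trans h4

theorem evalAt_onePlusXPow (w : TorsionPoint p F n) (j : Fin n) (b : ℤ_[p]) :
    evalAt w (onePlusXPow F j b) = val (zpPow (w j) b) := by
  obtain ⟨k, hk⟩ := exists_pow_eq_one (w j)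
  obtain ⟨c, hc⟩ := Ideal.mem_span_singleton.1 (b.appr_spec k)
  rw [zpPow_eq hk, show b = (b.appr k : ℕ) + p ^ k * c by rw [← hc]; ring, onePlusXPow_add,
    map_mul, evalAt_onePlusXPow_pow_mul hk, mul_one, onePlusXPow_natCast, map_pow, map_add, map_one,
    evalAt_X, add_sub_cancel, ← hc, add_sub_cancel, map_pow]

theorem evalAt_swapSubst (i j : Fin n) (w : TorsionPoint p F n)
    (f : MvPowerSeries (Fin n) (IntegerRing p F)) :
    evalAt w (swapSubst p F i j f) = evalAt (fun k ↦ w (Equiv.swap i j k)) f :=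
  DFunLike.congr_fun (eq_evalAt (φ := (evalAt w).comp
    (swapSubst p F i j : MvPowerSeries (Fin n) (IntegerRing p F) →+* _))
    (fun c ↦ by
      rw [RingHom.comp_apply, RingHom.coe_coe, swapSubst_C, evalAt_C])
    (fun k ↦ by
      rw [RingHom.comp_apply, RingHom.coe_coe, swapSubst_X, evalAt_X])) f

/-- The action on torsion points of the substitution given by `columnMatrix r b`. -/
noncomputable def shear (r : Fin n) (b : Fin n → ℤ_[p]) (w : TorsionPoint p F n) :
    TorsionPoint p F n :=
  fun i ↦ if r < i then w i * zpPow (w r) (b i) else w i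

omit [Algebra ℚ_[p] F] [IsScalarTower ℤ_[p] ℚ_[p] F] [FiniteDimensional ℚ_[p] F] in
theorem shear_mul (r : Fin n) (b : Fin n → ℤ_[p]) (v w : TorsionPoint p F n) :
    shear r b (v * w) = shear r b v * shear r b w := by
  funext i
  simp only [shear, Pi.mul_apply, zpPow_mul]
  split_ifs
  · exact mul_mul_mul_comm _ _ _ _
  · rfl

omit [Algebra ℚ_[p] F] [IsScalarTower ℤ_[p] ℚ_[p] F] [FiniteDimensional ℚ_[p] F] in
theorem shear_surjective (r : Fin n) (b : Fin n → ℤ_[p]) :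
    Function.Surjective (shear (F := F) r b) := fun w ↦ by
  refine ⟨fun i ↦ if r < i then w i * (zpPow (w r) (b i))⁻¹ else w i, funext fun i ↦ ?_⟩
  simp only [shear, if_neg (lt_irrefl r)]
  split_ifs
  · rw [inv_mul_cancel_right]
  · rfl

theorem evalAt_triangularSubst (r : Fin n) (b : Fin n → ℤ_[p]) (w : TorsionPoint p F n)
    (f : MvPowerSeries (Fin n) (IntegerRing p F)) :
    evalAt w (triangularSubst F (columnMatrix r b) f) = evalAt (shear r b w) f :=
  DFunLike.congr_fun (eq_evalAt (φ := (evalAt w).comp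
    (triangularSubst F (columnMatrix r b) : MvPowerSeries (Fin n) (IntegerRing p F) →+* _))
    (fun c ↦ by
      rw [RingHom.comp_apply, RingHom.coe_coe, triangularSubst_C, evalAt_C])
    (fun k ↦ by
      rw [RingHom.comp_apply, RingHom.coe_coe, triangularSubst_X, triangularSeries_columnMatrix,
        shear]
      split_ifs
      · rw [map_sub, map_mul, map_add, map_one, evalAt_X, evalAt_onePlusXPow, add_sub_cancel,
          map_mul]
      · rw [evalAt_X])) f

end ChangesOfVariables
end FormalTorus

namespace FormalTorus

open MvPowerSeries

/-! ### The topology on torsion points and special closures. -/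

section ZeroSets

variable {p : ℕ} [Fact p.Prime] {F : Type*} [Field F] [Algebra ℤ_[p] F]
  [Algebra ℚ_[p] F] [IsScalarTower ℤ_[p] ℚ_[p] F] [FiniteDimensional ℚ_[p] F] {n : ℕ}

/-- The prime ideal of power series vanishing at a torsion point. -/
noncomputable def toSpec (w : TorsionPoint p F n) :
    PrimeSpectrum (MvPowerSeries (Fin n) (IntegerRing p F)) :=
  ⟨RingHom.ker (evalAt w), RingHom.ker_isPrime _⟩

/-- The topology on torsion points whose closed sets are the zero sets of power series over
`𝓞_F`. -/
noncomputable instance torsionPointTopology : TopologicalSpace (TorsionPoint p F n) :=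
  TopologicalSpace.induced toSpec inferInstance

theorem isInducing_toSpec : Topology.IsInducing (toSpec : TorsionPoint p F n → _) := ⟨rfl⟩

instance torsionPoint_noetherianSpace :
    TopologicalSpace.NoetherianSpace (TorsionPoint p F n) :=
  have := integerRing_isNoetherianRing p F
  isInducing_toSpec.noetherianSpace

theorem isClosed_iff_exists {V : Set (TorsionPoint p F n)} :
    IsClosed V ↔ ∃ s : Set (MvPowerSeries (Fin n) (IntegerRing p F)),
      V = {w | ∀ f ∈ s, evalAt w f = 0} := by
  rw [isInducing_toSpec.isClosed_iff]
  simp_rw [PrimeSpectrum.isClosed_iff_zeroLocus]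
  constructor
  · rintro ⟨_, ⟨s, rfl⟩, rfl⟩
    exact ⟨s, rfl⟩
  · rintro ⟨s, rfl⟩
    exact ⟨_, ⟨s, rfl⟩, rfl⟩

theorem isClosed_setOf_forall (s : Set (MvPowerSeries (Fin n) (IntegerRing p F))) :
    IsClosed {w : TorsionPoint p F n | ∀ f ∈ s, evalAt w f = 0} :=
  isClosed_iff_exists.2 ⟨s, rfl⟩

theorem continuous_of_evalAt {α : TorsionPoint p F n → TorsionPoint p F n}
    (σ : MvPowerSeries (Fin n) (IntegerRing p F) → MvPowerSeries (Fin n) (IntegerRing p F))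
    (h : ∀ w f, evalAt w (σ f) = evalAt (α w) f) : Continuous α := by
  refine continuous_iff_isClosed.2 fun V hV ↦ ?_
  obtain ⟨s, rfl⟩ := isClosed_iff_exists.1 hV
  refine isClosed_iff_exists.2 ⟨σ '' s, ?_⟩
  ext w
  simp [h]

theorem isClosed_setOf_forall_mul_pow_mem {V : Set (TorsionPoint p F n)} (hV : IsClosed V) {k : ℕ}
    {η : TorsionPoint p F n} (hη : η ^ p ^ k = 1) : IsClosed {w | ∀ t : ℕ, w * η ^ t ∈ V} := by
  obtain ⟨s, rfl⟩ := isClosed_iff_exists.1 hV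
  choose c hc using exists_forall_evalAt_mul_pow_eq_zero_iff hη
  refine isClosed_iff_exists.2 ⟨{g | ∃ f ∈ s, ∃ j, g = c f j}, ?_⟩
  ext w
  constructor
  · rintro h _ ⟨f, hf, j, rfl⟩
    exact (hc f w).1 (fun t ↦ h t f hf) j
  · exact fun h t f hf ↦ (hc f w).2 (fun j ↦ h _ ⟨f, hf, j, rfl⟩) t

theorem isClosed_setOf_pow_eq_one (T : Set (Fin n)) (N : ℕ) :
    IsClosed {w : TorsionPoint p F n | ∀ i ∈ T, w i ^ p ^ N = 1} := by
  refine isClosed_iff_exists.2 ⟨(fun i ↦ (1 + X i) ^ p ^ N - 1) '' T, ?_⟩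
  ext w
  simp only [Set.mem_ofPred_eq, Set.forall_mem_image]
  refine forall₂_congr fun i _ ↦ ?_
  rw [map_sub, map_pow, map_add, map_one, evalAt_X, add_sub_cancel, sub_eq_zero, ← map_pow,
    map_eq_one_iff _ val_injective]

omit [Algebra ℚ_[p] F] [IsScalarTower ℤ_[p] ℚ_[p] F] [FiniteDimensional ℚ_[p] F] in
theorem finite_setOf_pow_eq_one (N : ℕ) : {w : TorsionPoint p F n | w ^ p ^ N = 1}.Finite := by
  have hpos : 0 < p ^ N := pow_pos (Fact.out : p.Prime).pos _
  have h1 : {u : torsionGroup p F | u ^ p ^ N = 1}.Finite := by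
    refine Set.Finite.of_finite_image (f := val)
      ((Polynomial.nthRootsFinset (p ^ N) (1 : ClosureRing p F)).finite_toSet.subset ?_)
      val_injective.injOn
    rintro _ ⟨u, hu, rfl⟩
    rw [Finset.mem_coe, Polynomial.mem_nthRootsFinset hpos, ← map_pow, hu, map_one]
  refine (Set.Finite.pi' fun _ : Fin n ↦ h1).subset fun w hw i ↦ ?_
  exact congrFun hw i

/-- The ideals of the intersections of hyperplanes, up to surjective multiplicative changes of
variables. -/
def IsSpecialPrime (D : Ideal (MvPowerSeries (Fin n) (IntegerRing p F))) : Prop :=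
  ∃ σ : MvPowerSeries (Fin n) (IntegerRing p F) →ₐ[IntegerRing p F]
      MvPowerSeries (Fin n) (IntegerRing p F),
    IsMulChangeOfVariables p σ ∧ Function.Surjective σ ∧ ∃ (T : Set (Fin n))
      (K : IntermediateField F (AlgebraicClosure F)) (_ : FiniteDimensional F K)
      (z : Fin n → IntegerRing p K), (∀ i, ∃ k : ℕ, z i ^ p ^ k = 1) ∧
        D = (sliceIdeal p K T z).comap σ

/-- The closure of a set of torsion points is a finite union of special subschemes. -/
def HasSpecialClosure (V : Set (TorsionPoint p F n)) : Prop :=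
  ∃ 𝒟 : Set (Ideal (MvPowerSeries (Fin n) (IntegerRing p F))), 𝒟.Finite ∧
    (∀ D ∈ 𝒟, IsSpecialPrime D ∧ ∀ f, (∀ w ∈ V, evalAt w f = 0) → f ∈ D) ∧
      ∀ w ∈ V, ∃ D ∈ 𝒟, D ≤ RingHom.ker (evalAt w)

theorem isSpecialPrime_sliceIdeal (T : Set (Fin n))
    (K : IntermediateField F (AlgebraicClosure F)) [FiniteDimensional F K]
    {z : Fin n → IntegerRing p K} (hz : ∀ i, ∃ k : ℕ, z i ^ p ^ k = 1) :
    IsSpecialPrime (sliceIdeal p K T z) := by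
  have hid : ∀ f : MvPowerSeries (Fin n) (IntegerRing p F),
      triangularSubst F (0 : Fin n → Fin n → ℤ_[p]) f = f := algHom_eq_id_of_X fun i ↦ by
    rw [triangularSubst_X, triangularSeries]
    simp [onePlusXPow_zero]
  refine ⟨triangularSubst F 0, .triangular 0, fun f ↦ ⟨f, hid f⟩, T, K, inferInstance, z, hz, ?_⟩
  ext f
  rw [Ideal.mem_comap, hid]

omit [Algebra ℚ_[p] F] [IsScalarTower ℤ_[p] ℚ_[p] F] [FiniteDimensional ℚ_[p] F] in
theorem IsSpecialPrime.comap {D : Ideal (MvPowerSeries (Fin n) (IntegerRing p F))}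
    (hD : IsSpecialPrime D) {σ : MvPowerSeries (Fin n) (IntegerRing p F) →ₐ[IntegerRing p F]
      MvPowerSeries (Fin n) (IntegerRing p F)} (hσ : IsMulChangeOfVariables p σ)
    (hs : Function.Surjective σ) : IsSpecialPrime (D.comap σ) := by
  obtain ⟨τ, hτ, ht, T, K, hK, z, hz, rfl⟩ := hD
  exact ⟨τ.comp σ, .comp hτ hσ, ht.comp hs, T, K, hK, z, hz, rfl⟩

/-- Lets a change of variables be made on the points; the primes found for the preimage are
contracted along `σ`. -/
theorem HasSpecialClosure.of_preimage {V : Set (TorsionPoint p F n)}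
    {α : TorsionPoint p F n → TorsionPoint p F n} (hα : Function.Surjective α)
    {σ : MvPowerSeries (Fin n) (IntegerRing p F) →ₐ[IntegerRing p F]
      MvPowerSeries (Fin n) (IntegerRing p F)} (hσ : IsMulChangeOfVariables p σ)
    (hs : Function.Surjective σ) (h : ∀ w f, evalAt w (σ f) = evalAt (α w) f)
    (hV : HasSpecialClosure (α ⁻¹' V)) : HasSpecialClosure V := by
  obtain ⟨𝒟, hfin, h1, h2⟩ := hV
  refine ⟨(fun D ↦ D.comap σ) '' 𝒟, hfin.image _, ?_, fun w hw ↦ ?_⟩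
  · rintro _ ⟨D, hD, rfl⟩
    exact ⟨(h1 D hD).1.comap hσ hs, fun f hf ↦ (h1 D hD).2 (σ f) fun w hw ↦ by
      rw [h, hf _ hw]⟩
  · obtain ⟨v, rfl⟩ := hα w
    obtain ⟨D, hD, hle⟩ := h2 v hw
    refine ⟨_, ⟨D, hD, rfl⟩, fun f hf ↦ ?_⟩
    rw [RingHom.mem_ker, ← h]
    exact hle hf

theorem HasSpecialClosure.sUnion {𝒱 : Set (Set (TorsionPoint p F n))} (hfin : 𝒱.Finite)
    (h : ∀ V ∈ 𝒱, HasSpecialClosure V) : HasSpecialClosure (⋃₀ 𝒱) := by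
  choose! 𝒟 h1 h2 h3 using h
  refine ⟨⋃ V ∈ 𝒱, 𝒟 V, hfin.biUnion h1, ?_, ?_⟩
  · intro D hD
    simp only [Set.mem_iUnion] at hD
    obtain ⟨V, hV, hD⟩ := hD
    exact ⟨(h2 V hV D hD).1, fun f hf ↦ (h2 V hV D hD).2 f fun w hw ↦ hf w ⟨V, hV, hw⟩⟩
  · rintro w ⟨V, hV, hw⟩
    obtain ⟨D, hD, hle⟩ := h3 V hV w hw
    exact ⟨D, Set.mem_biUnion hV hD, hle⟩

/-- Invariance under the torsion points that are trivial in all coordinates from `r` on. -/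
def IsStableUpTo (r : ℕ) (V : Set (TorsionPoint p F n)) : Prop :=
  ∀ h : TorsionPoint p F n, (∀ i : Fin n, r ≤ i → h i = 1) → ∀ w ∈ V, h * w ∈ V

/-- The point that agrees with `w` from coordinate `r` on and is trivial before. -/
noncomputable def truncBelow (r : ℕ) (w : TorsionPoint p F n) : TorsionPoint p F n :=
  fun i ↦ if r ≤ i then w i else 1

omit [Algebra ℚ_[p] F] [IsScalarTower ℤ_[p] ℚ_[p] F] [FiniteDimensional ℚ_[p] F] in
theorem IsStableUpTo.mem_of_eq {r : ℕ} {V : Set (TorsionPoint p F n)} (hV : IsStableUpTo r V)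
    {v w : TorsionPoint p F n} (hv : v ∈ V) (h : ∀ i : Fin n, r ≤ i → w i = v i) : w ∈ V := by
  have := hV (w * v⁻¹) (fun i hi ↦ by
    rw [Pi.mul_apply, Pi.inv_apply, h i hi, mul_inv_cancel]) v hv
  rwa [inv_mul_cancel_right] at this

omit [Algebra ℚ_[p] F] [IsScalarTower ℤ_[p] ℚ_[p] F] [FiniteDimensional ℚ_[p] F] in
theorem IsStableUpTo.truncBelow_mem {r : ℕ} {V : Set (TorsionPoint p F n)} (hV : IsStableUpTo r V)
    {w : TorsionPoint p F n} (hw : w ∈ V) : truncBelow r w ∈ V :=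
  hV.mem_of_eq hw fun _ hi ↦ if_pos hi

/-- The coordinates from `r` on take finitely many values, and by stability the others are free. So
`V` consists of all torsion points on finitely many slices, and density identifies the closure. -/
theorem hasSpecialClosure_of_pow_eq_one {r N : ℕ} {V : Set (TorsionPoint p F n)}
    (hV : IsStableUpTo r V) (hN : ∀ w ∈ V, ∀ i : Fin n, r ≤ i → w i ^ p ^ N = 1) :
    HasSpecialClosure V := by
  choose K hK _ z hz hz' using exists_inclusionMap_eq_val (p := p) (F := F) (n := n) ⊥
  let T : Set (Fin n) := {i | r ≤ i}
  refine ⟨(fun v ↦ sliceIdeal p (K v) T (z v)) '' (truncBelow r '' V), ?_, ?_, ?_⟩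
  · refine ((finite_setOf_pow_eq_one N).subset ?_).image _
    rintro _ ⟨w, hw, rfl⟩
    funext i
    by_cases hi : r ≤ i
    · simpa [truncBelow, hi] using hN w hw i hi
    · simp [truncBelow, hi]
  · rintro _ ⟨_, ⟨w, hw, rfl⟩, rfl⟩
    have := hK (truncBelow r w)
    refine ⟨isSpecialPrime_sliceIdeal _ _ (hz' _), fun f hf ↦
      mem_sliceIdeal_of_forall_evalAt (hz' _) fun v hv ↦ hf v (hV.mem_of_eq hw fun i hi ↦ ?_)⟩
    apply val_injective
    have hi' : r ≤ (i : ℕ) := hi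
    rw [← hv i hi, hz, truncBelow, if_pos hi']
  · intro w hw
    refine ⟨_, ⟨_, ⟨w, hw, rfl⟩, rfl⟩, ?_⟩
    have := hK (truncBelow r w)
    refine sliceIdeal_le_ker_evalAt (hz' _) fun i hi ↦ ?_
    have hi' : r ≤ (i : ℕ) := hi
    rw [hz, truncBelow, if_pos hi']

end ZeroSets
end FormalTorus

namespace FormalTorus

open MvPowerSeries

/-! ### König's lemma for torsion groups. -/

section CoherentSequences

/-- König's lemma for `p`-power torsion: unbounded torsion yields a coherent sequence of
`p`-power roots of a nontrivial element. -/
theorem exists_coherent_seq {G : Type*} [CommGroup G] {p : ℕ} {P : G → Prop}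
    (hpow : ∀ g t, P g → P (g ^ t)) (hfin : ∀ k : ℕ, {g : G | g ^ p ^ k = 1}.Finite)
    (htors : ∀ g : G, ∃ k : ℕ, g ^ p ^ k = 1) (h : ∀ k : ℕ, ∃ g, P g ∧ g ^ p ^ k ≠ 1) :
    ∃ ξ : ℕ → G, (∀ j, P (ξ j)) ∧ (∀ j, ξ (j + 1) ^ p = ξ j) ∧ ξ 0 ^ p = 1 ∧ ξ 0 ≠ 1 := by
  -- The nodes with infinitely long branches above them. Since `P` passes to powers, the pigeonhole
  -- principle puts such a node in any finite set reached from every height.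
  let Deep : G → Prop := fun x ↦ ∀ k : ℕ, ∃ y, P y ∧ y ^ p ^ k = x
  have pigeon : ∀ (S : Set G), S.Finite → ∀ y : ℕ → G, (∀ k, P (y k)) →
      (∀ k, y k ^ p ^ k ∈ S) → ∃ x ∈ S, Deep x := by
    intro S hS y hP hy
    have := hS.to_subtype
    obtain ⟨x, hx⟩ := Finite.exists_infinite_fiber (fun k ↦ (⟨y k ^ p ^ k, hy k⟩ : S))
    refine ⟨x, x.2, fun k ↦ ?_⟩
    obtain ⟨l, hl, hkl⟩ := (Set.infinite_coe_iff.1 hx).exists_gt k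
    refine ⟨y l ^ p ^ (l - k), hpow _ _ (hP l), ?_⟩
    rw [← pow_mul, ← pow_add, Nat.sub_add_cancel hkl.le]
    exact congrArg Subtype.val hl
  -- Elements of exact order `p ^ (k + 1)`; their `p ^ k`-th powers are nontrivial and lie in the
  -- finite `p`-torsion, where the sequence starts.
  have hstart : ∀ k : ℕ, ∃ y, P y ∧ y ^ p ^ (k + 1) = 1 ∧ y ^ p ^ k ≠ 1 := by
    intro k
    obtain ⟨g, hg, hk⟩ := h k
    classical
    have hj := Nat.find_spec (htors g)
    have hmin := fun {m} ↦ Nat.find_min (htors g) (m := m)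
    set j := Nat.find (htors g)
    have hkj : k < j := by
      by_contra! hle
      exact hk (by rw [← Nat.add_sub_cancel' hle, pow_add, pow_mul, hj, one_pow])
    refine ⟨g ^ p ^ (j - (k + 1)), hpow _ _ hg, ?_, ?_⟩
    · rw [← pow_mul, ← pow_add, Nat.sub_add_cancel hkj, hj]
    · rw [← pow_mul, ← pow_add]
      exact hmin (by omega)
  choose y hyP hy1 hy2 using hstart
  obtain ⟨x₀, ⟨hx1, hx2⟩, hx₀⟩ := pigeon {g | g ^ p ^ 1 = 1 ∧ g ≠ 1}
    ((hfin 1).subset fun g hg ↦ hg.1) y hyP fun k ↦ ⟨by rw [← pow_mul, ← pow_add, hy1], hy2 k⟩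
  have step : ∀ x : {x // Deep x}, ∃ x' : {x // Deep x}, x'.1 ^ p = x.1 := by
    rintro ⟨x, hx⟩
    obtain ⟨N, hN⟩ := htors x
    choose z hzP hz using fun k ↦ hx (k + 1)
    obtain ⟨x', hx', hd⟩ := pigeon {g | g ^ p = x}
        ((hfin (N + 1)).subset fun g (hg : g ^ p = x) ↦ by
      change g ^ p ^ (N + 1) = 1
      rw [pow_succ', pow_mul, hg, hN]) z hzP fun k ↦ by
        change (z k ^ p ^ k) ^ p = x
        rw [← pow_mul, ← pow_succ, hz]
    exact ⟨⟨x', hd⟩, hx'⟩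
  choose next hnext using step
  let ξ : ℕ → {x // Deep x} := fun j ↦ Nat.rec ⟨x₀, hx₀⟩ (fun _ x ↦ next x) j
  refine ⟨fun j ↦ (ξ j).1, fun j ↦ ?_, fun j ↦ hnext (ξ j), (pow_one p ▸ hx1 :), hx2⟩
  obtain ⟨y, hy, hyx⟩ := (ξ j).2 0
  rw [pow_zero, pow_one] at hyx
  exact (hyx ▸ hy :)

theorem pow_prime_pow_eq_one_of_coherent {G : Type*} [Group G] {p : ℕ} {ξ : ℕ → G}
    (h : ∀ j, ξ (j + 1) ^ p = ξ j) (h0 : ξ 0 ^ p = 1) (j : ℕ) : ξ j ^ p ^ (j + 1) = 1 := by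
  induction j with
  | zero => simpa using h0
  | succ j ih => rw [pow_succ', pow_mul, h, ih]

theorem orderOf_eq_of_coherent {G : Type*} [Group G] {p : ℕ} [Fact p.Prime] {ξ : ℕ → G}
    (h : ∀ j, ξ (j + 1) ^ p = ξ j) (h0 : ξ 0 ^ p = 1) (h1 : ξ 0 ≠ 1) (j : ℕ) :
    orderOf (ξ j) = p ^ (j + 1) := by
  refine orderOf_eq_prime_pow ?_ (pow_prime_pow_eq_one_of_coherent h h0 j)
  have : ∀ j, ξ j ^ p ^ j = ξ 0 := fun j ↦ by
    induction j with
    | zero => simp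
    | succ j ih => rw [pow_succ', pow_mul, h, ih]
  rwa [this]

end CoherentSequences

/-! ### Unbounded torsion produces translations; induction on the stable coordinates. -/

section Stability

variable {p : ℕ} [Fact p.Prime] {F : Type*} [Field F] [Algebra ℤ_[p] F] {n : ℕ}

theorem exists_pow_eq_of_orderOf {u v : torsionGroup p F} {N : ℕ} (hN : 0 < N)
    (hu : orderOf u = N) (hv : v ^ N = 1) : ∃ e : ℕ, u ^ e = v := by
  have : NeZero N := ⟨hN.ne'⟩
  have h : IsPrimitiveRoot (val u) N :=
    (hu ▸ IsPrimitiveRoot.orderOf u).map_of_injective val_injective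
  obtain ⟨e, -, he⟩ := h.eq_pow_of_pow_eq_one (ξ := val v) (by rw [← map_pow, hv, map_one])
  exact ⟨e, val_injective (by rw [map_pow, he])⟩

theorem zpPow_eq_of_dvd {u : torsionGroup p F} {k e : ℕ} (hu : u ^ p ^ k = 1) {b : ℤ_[p]}
    (h : (p : ℤ_[p]) ^ k ∣ b - e) : zpPow u b = u ^ e := by
  rw [zpPow_eq hu]
  have h1 : (p : ℤ_[p]) ^ k ∣ ((e - b.appr k : ℤ) : ℤ_[p]) := by
    have := dvd_sub (Ideal.mem_span_singleton.1 (b.appr_spec k)) h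
    push_cast
    convert this using 1
    ring
  have h2 : (b.appr k : ℤ) ≡ e [ZMOD (p ^ k : ℕ)] :=
    Int.modEq_iff_dvd.2 (by exact_mod_cast (PadicInt.pow_p_dvd_int_iff k _).1 h1)
  exact pow_eq_pow_iff_modEq.2 (((Int.natCast_modEq_iff).1 h2).of_dvd
    (orderOf_dvd_of_pow_eq_one hu))

/-- A coherent sequence in `μ_{p^∞}` is the power by a `p`-adic integer of a nontrivial one. -/
theorem exists_zpPow_eq_of_coherent {ξ ξ' : ℕ → torsionGroup p F} (h : ∀ j, ξ (j + 1) ^ p = ξ j)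
    (h0 : ξ 0 ^ p = 1) (h1 : ξ 0 ≠ 1) (h' : ∀ j, ξ' (j + 1) ^ p = ξ' j) (h0' : ξ' 0 ^ p = 1) :
    ∃ b : ℤ_[p], ∀ j, zpPow (ξ j) b = ξ' j := by
  have hp : p.Prime := Fact.out
  have hord := orderOf_eq_of_coherent h h0 h1
  choose e he using fun j ↦ exists_pow_eq_of_orderOf (pow_pos hp.pos _) (hord j)
    (pow_prime_pow_eq_one_of_coherent h' h0' j)
  have hmod : ∀ j, (p : ℤ_[p]) ^ (j + 1) ∣ (e (j + 1) : ℤ_[p]) - e j := fun j ↦ by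
    have : ξ j ^ e j = ξ j ^ e (j + 1) := by
      rw [he, ← h', ← he, ← pow_mul, mul_comm, pow_mul, h]
    rw [pow_eq_pow_iff_modEq, hord, ← Int.natCast_modEq_iff, Int.modEq_iff_dvd] at this
    have h3 := (PadicInt.pow_p_dvd_int_iff (p := p) (j + 1) _).2 (by exact_mod_cast this)
    exact_mod_cast h3
  have := isAdicComplete_span_natCast p ℤ_[p]
  obtain ⟨b, hb⟩ := IsPrecomplete.prec (I := Ideal.span {(p : ℤ_[p])}) inferInstance
    (f := fun j ↦ (e j : ℤ_[p])) (fun {m k} hmk ↦ by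
      induction k, hmk using Nat.le_induction with
      | base => rfl
      | succ k hk ih =>
        refine ih.trans (SModEq.symm (SModEq.sub_mem.2 ?_))
        rw [smul_eq_mul, Ideal.mul_top, Ideal.span_singleton_pow, Ideal.mem_span_singleton]
        exact (pow_dvd_pow _ (hk.trans k.le_succ)).trans (hmod k))
  refine ⟨b, fun j ↦ ?_⟩
  rw [← he, zpPow_eq_of_dvd (hord j ▸ pow_orderOf_eq_one (ξ j))]
  -- The limit is known modulo `p ^ (j + 1)` only against `e (j + 1)`; `hmod j` passes from there to
  -- `e j`.
  have h4 := SModEq.sub_mem.1 (hb (j + 1)).symm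
  rw [smul_eq_mul, Ideal.mul_top, Ideal.span_singleton_pow, Ideal.mem_span_singleton] at h4
  simpa using dvd_add h4 (hmod j)

theorem zpPow_pow (u : torsionGroup p F) (b : ℤ_[p]) (t : ℕ) : zpPow (u ^ t) b = zpPow u b ^ t := by
  induction t with
  | zero => rw [pow_zero, pow_zero, zpPow_eq (k := 0) (one_pow _), one_pow]
  | succ t ih => rw [pow_succ, zpPow_mul, ih, pow_succ]

theorem zpPow_mul_zpPow_neg (u : torsionGroup p F) (b : ℤ_[p]) :
    zpPow u b * zpPow u (-b) = 1 := by
  obtain ⟨k, hk⟩ := exists_pow_eq_one u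
  rw [zpPow_eq hk b, zpPow_eq hk, ← pow_add, ← orderOf_dvd_iff_pow_eq_one]
  refine (orderOf_dvd_of_pow_eq_one hk).trans ?_
  have h1 := dvd_add (Ideal.mem_span_singleton.1 (b.appr_spec k))
    (Ideal.mem_span_singleton.1 ((-b).appr_spec k))
  have h2 : (p : ℤ_[p]) ^ k ∣ ((b.appr k + (-b).appr k : ℤ) : ℤ_[p]) := by
    rw [← dvd_neg]
    push_cast
    convert h1 using 1
    ring
  exact_mod_cast (PadicInt.pow_p_dvd_int_iff k _).1 h2

theorem shear_shear_neg (r : Fin n) (b : Fin n → ℤ_[p]) (w : TorsionPoint p F n) :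
    shear r b (shear r (-b) w) = w := by
  funext i
  simp only [shear, lt_irrefl, if_false]
  split_ifs
  · rw [Pi.neg_apply, mul_assoc, mul_comm (zpPow _ _), zpPow_mul_zpPow_neg, mul_one]
  · rfl

/-- The torsion points trivial in the coordinates below `r` whose powers act on `V`. -/
def IsTranslation (r : ℕ) (V : Set (TorsionPoint p F n)) (η : TorsionPoint p F n) : Prop :=
  (∀ i : Fin n, (i : ℕ) < r → η i = 1) ∧ ∀ w ∈ V, ∀ t : ℕ, w * η ^ t ∈ V

theorem IsTranslation.pow {r : ℕ} {V : Set (TorsionPoint p F n)} {η : TorsionPoint p F n}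
    (h : IsTranslation r V η) (t : ℕ) : IsTranslation r V (η ^ t) :=
  ⟨fun i hi ↦ by rw [Pi.pow_apply, h.1 i hi, one_pow], fun w hw s ↦ by
    rw [← pow_mul]
    exact h.2 w hw _⟩

/-- The shear carries the `r`-th axis to the subgroup swept out by `ξ`. A point supported up to `r`
thus maps to a power of some `ξ k` times a point supported below `r`, and both factors preserve `V`.
-/
theorem isStableUpTo_succ_preimage_shear {r : Fin n} {V : Set (TorsionPoint p F n)}
    (hV : IsStableUpTo r V) {ξ : ℕ → TorsionPoint p F n} (hξ : ∀ j, IsTranslation r V (ξ j))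
    (h : ∀ j, ξ (j + 1) ^ p = ξ j) (h0 : ξ 0 ^ p = 1) (h1 : ξ 0 r ≠ 1) {b : Fin n → ℤ_[p]}
    (hb : ∀ l j, zpPow (ξ j r) (b l) = ξ j l) : IsStableUpTo (r + 1) (shear r b ⁻¹' V) := by
  intro g hg w hw
  have hr : ∀ j, ξ (j + 1) r ^ p = ξ j r := fun j ↦ congrFun (h j) r
  have hr0 : ξ 0 r ^ p = 1 := congrFun h0 r
  obtain ⟨k, hk⟩ := exists_pow_eq_one (g r)
  obtain ⟨t, ht⟩ := exists_pow_eq_of_orderOf (pow_pos (Fact.out : p.Prime).pos _)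
    (orderOf_eq_of_coherent (ξ := fun j ↦ ξ j r) hr hr0 h1 k) (v := g r)
    (by rw [pow_succ, pow_mul, hk, one_pow])
  have hgr : shear r b g = (fun i ↦ if i < r then g i else 1) * ξ k ^ t := by
    funext l
    simp only [shear, Pi.mul_apply, Pi.pow_apply]
    rcases lt_trichotomy l r with hl | rfl | hl
    · rw [if_neg hl.asymm, if_pos hl, (hξ k).1 l hl, one_pow, mul_one]
    · rw [if_neg (lt_irrefl l), if_neg (lt_irrefl l), one_mul, ht]
    · rw [if_pos hl, if_neg hl.asymm, hg l hl, ← ht, zpPow_pow, hb]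
  rw [Set.mem_preimage, shear_mul, hgr, mul_assoc, mul_comm (ξ k ^ t)]
  exact hV _ (fun i hi ↦ if_neg (by simpa using hi)) _ ((hξ k).2 _ hw t)

variable [Algebra ℚ_[p] F] [IsScalarTower ℤ_[p] ℚ_[p] F] [FiniteDimensional ℚ_[p] F]

theorem pow_mem_of_isClosed {V : Set (TorsionPoint p F n)} (hV : IsClosed V)
    {w : TorsionPoint p F n} (hwV : w ∈ V) {m : ℕ} (hw : w ^ p ^ m = 1) {a : ℕ} (ha : a.Coprime p) :
    w ^ a ^ (Module.finrank ℚ_[p] F).factorial ∈ V := by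
  obtain ⟨s, rfl⟩ := isClosed_iff_exists.1 hV
  exact fun f hf ↦ evalAt_pow_eq_zero (fun i ↦ congrFun hw i) ha (hwV f hf)

theorem pow_one_add_mul_pow {G : Type*} [CommMonoid G] {w : G} {M x : ℕ} (hw : w ^ M = 1)
    (hx : M ∣ x ^ 2) (c : ℕ) : w ^ (1 + x) ^ c = w * w ^ (c * x) := by
  obtain ⟨q, hq⟩ : ∃ q, (1 + x) ^ c = 1 + c * x + x ^ 2 * q := by
    induction c with
    | zero => exact ⟨0, by simp⟩
    | succ c ih =>
      obtain ⟨q, hq⟩ := ih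
      exact ⟨c + q + q * x, by rw [pow_succ, hq]; ring⟩
  obtain ⟨y, hy⟩ := hx
  rw [hq, pow_add, pow_add, pow_one, hy, mul_assoc M, pow_mul w M, hw, one_pow, mul_one]

/-- The heart of the proof. Galois conjugates of a point of large order form an orbit under some `η`
from a fixed finite set. The closed sets of points having such an orbit in `V`, together with the
points of bounded order, cover `V`; irreducibility selects one of them. -/
theorem exists_isTranslation_of_isIrreducible {r : ℕ} {V : Set (TorsionPoint p F n)}
    (hV : IsClosed V) (hirr : IsIrreducible V) (hst : IsStableUpTo r V)
    (hN : ¬ ∃ N : ℕ, ∀ w ∈ V, ∀ i : Fin n, r ≤ i → w i ^ p ^ N = 1) (k : ℕ) :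
    ∃ η, IsTranslation r V η ∧ η ^ p ^ k ≠ 1 := by
  have hp : p.Prime := Fact.out
  set c := (Module.finrank ℚ_[p] F).factorial with hc
  have hc0 : 0 < c := Nat.factorial_pos _
  let A : Set (TorsionPoint p F n) :=
    {η | η ^ p ^ (k + c) = 1 ∧ (∀ i : Fin n, (i : ℕ) < r → η i = 1) ∧ η ^ p ^ k ≠ 1}
  have hA : A.Finite := (finite_setOf_pow_eq_one (k + c)).subset fun η hη ↦ hη.1
  -- Outside `S` the order `p ^ m` of the truncated point has `m > 2 * (k + c)`, which makes `p ^ m`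
  -- divide the square of `p ^ (m - (k + c))`.
  let S : Set (TorsionPoint p F n) :=
    {w | ∀ i ∈ {i : Fin n | r ≤ i}, w i ^ p ^ (2 * (k + c)) = 1}
  let 𝒯 : Set (Set (TorsionPoint p F n)) := insert S ((fun η ↦ {w | ∀ t : ℕ, w * η ^ t ∈ V}) '' A)
  have h𝒯 : 𝒯.Finite := (hA.image _).insert _
  obtain ⟨Z, hZ, hVZ⟩ := isIrreducible_iff_sUnion_isClosed.1 hirr h𝒯.toFinset (by
    intro Z hZ
    rcases h𝒯.mem_toFinset.1 hZ with rfl | ⟨η, hη, rfl⟩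
    · exact isClosed_setOf_pow_eq_one _ _
    · exact isClosed_setOf_forall_mul_pow_mem hV hη.1) (by
    intro w hw
    rw [h𝒯.coe_toFinset]
    by_cases hwS : w ∈ S
    · exact ⟨S, .inl rfl, hwS⟩
    -- Truncation keeps the point in `V` by stability and makes its powers, among them `η`, trivial
    -- below `r`.
    set v := truncBelow r w with hv
    have hvV : v ∈ V := hst.truncBelow_mem hw
    obtain ⟨M, hM⟩ := exists_forall_pow_eq_one v
    obtain ⟨m, -, hm⟩ := (Nat.dvd_prime_pow hp).1
      (orderOf_dvd_of_pow_eq_one (x := v) (n := p ^ M) (funext hM))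
    have hvm : v ^ p ^ m = 1 := hm ▸ pow_orderOf_eq_one v
    have hNm : 2 * (k + c) < m := by
      by_contra! hle
      refine hwS fun i (hi : r ≤ (i : ℕ)) ↦ ?_
      have : v ^ p ^ (2 * (k + c)) = 1 := by
        rw [← Nat.add_sub_cancel' hle, pow_add, pow_mul, hvm, one_pow]
      simpa [hv, truncBelow, hi] using congrFun this i
    set x := p ^ (m - (k + c)) with hx
    refine ⟨_, .inr ⟨v ^ (c * x), ⟨?_, fun i hi ↦ ?_, fun h ↦ ?_⟩, rfl⟩, fun t ↦ ?_⟩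
    · rw [← pow_mul, mul_assoc, hx, ← pow_add, Nat.sub_add_cancel (by omega), mul_comm, pow_mul,
        hvm, one_pow]
    · simp [hv, truncBelow, hi.not_ge]
    -- If `η ^ p ^ k` were trivial, `p ^ m` would divide `c * p ^ (m - c)`, so `p ^ c ∣ c`, which is
    -- impossible as `0 < c < p ^ c`.
    · rw [← pow_mul, mul_assoc, hx, ← pow_add, show m - (k + c) + k = m - c by omega,
        ← orderOf_dvd_iff_pow_eq_one, hm] at h
      nth_rw 1 [show m = c + (m - c) by omega] at h
      rw [pow_add] at h
      exact (Nat.lt_pow_self hp.one_lt).not_ge (Nat.le_of_dvd hc0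
        (Nat.dvd_of_mul_dvd_mul_right (pow_pos hp.pos _) h))
    · have h1 : v ^ (1 + x * t) ^ c ∈ V := pow_mem_of_isClosed hV hvV hvm (by
        exact ((Nat.coprime_add_mul_left_left 1 x t).2 (Nat.coprime_one_left _)).coprime_dvd_right
          (dvd_pow_self _ (by omega)))
      rw [pow_one_add_mul_pow hvm, ← mul_assoc, pow_mul] at h1
      · refine hst.mem_of_eq h1 fun i hi ↦ ?_
        simp [hv, truncBelow, hi]
      · rw [mul_pow, hx, ← pow_mul]
        exact (pow_dvd_pow _ (by omega)).mul_right _)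
  rcases h𝒯.mem_toFinset.1 hZ with rfl | ⟨η, hη, rfl⟩
  · exact (hN ⟨_, fun w hw i hi ↦ hVZ hw i hi⟩).elim
  · exact ⟨η, ⟨hη.2.1, fun w hw t ↦ hVZ hw t⟩, hη.2.2⟩

theorem continuous_shear (r : Fin n) (b : Fin n → ℤ_[p]) : Continuous (shear (F := F) r b) :=
  continuous_of_evalAt _ (evalAt_triangularSubst r b)

theorem continuous_swap (i j : Fin n) :
    Continuous fun (w : TorsionPoint p F n) k ↦ w (Equiv.swap i j k) :=
  continuous_of_evalAt _ (evalAt_swapSubst i j)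

/-- Since `ξ` is nontrivial in coordinate `r`, every other coordinate is a `ℤ_p`-power of that one;
these exponents define the shear. -/
theorem hasSpecialClosure_of_coherent {r : Fin n}
    (ih : ∀ V : Set (TorsionPoint p F n), IsClosed V → IsIrreducible V → IsStableUpTo (r + 1) V →
      HasSpecialClosure V)
    {V : Set (TorsionPoint p F n)} (hV : IsClosed V) (hirr : IsIrreducible V)
    (hst : IsStableUpTo r V) {ξ : ℕ → TorsionPoint p F n} (hξ : ∀ j, IsTranslation r V (ξ j))
    (h : ∀ j, ξ (j + 1) ^ p = ξ j) (h0 : ξ 0 ^ p = 1) (h1 : ξ 0 r ≠ 1) : HasSpecialClosure V := by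
  choose b hb using fun l : Fin n ↦ exists_zpPow_eq_of_coherent (ξ := fun j ↦ ξ j r)
    (ξ' := fun j ↦ ξ j l) (fun j ↦ congrFun (h j) r) (congrFun h0 r) h1
    (fun j ↦ congrFun (h j) l) (congrFun h0 l)
  refine HasSpecialClosure.of_preimage (shear_surjective r b) (.triangular (columnMatrix r b))
    (triangularSubst_columnMatrix_surjective r b) (evalAt_triangularSubst r b)
    (ih _ (hV.preimage (continuous_shear r b)) ?_
      (isStableUpTo_succ_preimage_shear hst hξ h h0 h1 hb))
  have : shear r b ⁻¹' V = shear r (-b) '' V :=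
    (congrFun (Set.image_eq_preimage_of_inverse (fun w ↦ shear_shear_neg r b w)
      (fun w ↦ by simpa using shear_shear_neg r (-b) w)) V).symm
  rw [this]
  exact hirr.image _ (continuous_shear r (-b)).continuousOn

theorem hasSpecialClosure_of_isStableUpTo (k : ℕ) : ∀ {r : ℕ}, r + k = n →
    ∀ V : Set (TorsionPoint p F n), IsClosed V → IsIrreducible V → IsStableUpTo r V →
      HasSpecialClosure V := by
  induction k with
  | zero =>
    intro r hr V _ _ hst
    exact hasSpecialClosure_of_pow_eq_one (N := 0) hst fun w _ i hi ↦ by omega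
  | succ k ih =>
    intro r hr V hV hirr hst
    by_cases hN : ∃ N : ℕ, ∀ w ∈ V, ∀ i : Fin n, r ≤ i → w i ^ p ^ N = 1
    · obtain ⟨N, hN⟩ := hN
      exact hasSpecialClosure_of_pow_eq_one hst hN
    obtain ⟨ξ, hξ, h, h0, h1⟩ := exists_coherent_seq (P := IsTranslation r V)
      (fun _ t hg ↦ hg.pow t) finite_setOf_pow_eq_one
      (fun g ↦ (exists_forall_pow_eq_one g).imp fun _ ↦ funext)
      (exists_isTranslation_of_isIrreducible hV hirr hst hN)
    obtain ⟨i, hi⟩ := Function.ne_iff.1 h1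
    have hri : r ≤ i := by
      by_contra! hlt
      exact hi ((hξ 0).1 i hlt)
    -- The sequence is trivial below `r`, so a coordinate where `ξ 0` is nontrivial can be swapped
    -- into position `r` without touching the stable ones.
    let r' : Fin n := ⟨r, by omega⟩
    have hlow : ∀ l : Fin n, (l : ℕ) < r → Equiv.swap i r' l = l := fun l hl ↦
      Equiv.swap_apply_of_ne_of_ne (by rintro rfl; omega) (by rintro rfl; exact lt_irrefl _ hl)
    have hinv : Function.Involutive fun (w : TorsionPoint p F n) l ↦ w (Equiv.swap i r' l) :=
      fun w ↦ funext fun l ↦ congrArg w (Equiv.swap_apply_self _ _ _)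
    set α : TorsionPoint p F n → TorsionPoint p F n := fun w l ↦ w (Equiv.swap i r' l) with hα
    refine HasSpecialClosure.of_preimage hinv.surjective (.swap i r') (swapSubst_surjective i r')
      (evalAt_swapSubst i r') (hasSpecialClosure_of_coherent (r := r')
        (fun W ↦ ih (r := r + 1) (by omega) W) (hV.preimage (continuous_swap i r')) ?_ ?_
        (ξ := fun j ↦ α (ξ j)) (fun j ↦ ⟨fun l hl ↦ ?_, fun w hw t ↦ ?_⟩) (fun j ↦ ?_) ?_ ?_)
    · rw [← Set.image_eq_preimage_of_inverse hinv.leftInverse hinv.rightInverse]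
      exact hirr.image _ (continuous_swap i r').continuousOn
    · intro g hg w hw
      refine hst (α g) (fun l hl ↦ hg _ ?_) (α w) hw
      by_contra! hlt
      have := hlow _ hlt
      rw [Equiv.swap_apply_self] at this
      exact absurd hl (this ▸ hlt.not_ge)
    · exact (congrArg (ξ j) (hlow l hl)).trans ((hξ j).1 l hl)
    · change α w * α (α (ξ j)) ^ t ∈ V
      rw [hinv]
      exact (hξ j).2 _ hw t
    · exact congrArg α (h j)
    · exact congrArg α h0
    · change ξ 0 (Equiv.swap i r' r') ≠ 1
      rwa [Equiv.swap_apply_right]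

theorem hasSpecialClosure_of_isClosed {V : Set (TorsionPoint p F n)} (hV : IsClosed V) :
    HasSpecialClosure V := by
  obtain ⟨𝒱, hfin, hcl, hirr, hVeq⟩ :=
    TopologicalSpace.NoetherianSpace.exists_finite_set_isClosed_irreducible hV
  rw [hVeq]
  exact .sUnion hfin fun W hW ↦ hasSpecialClosure_of_isStableUpTo n (zero_add n) W
    (hcl W hW) (hirr W hW) fun h hh w hw ↦ by
      rwa [show h = 1 from funext fun i ↦ hh i (Nat.zero_le _), one_mul]

end Stability
end FormalTorus

namespace FormalTorus

open MvPowerSeries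

/-! ### Krull dimension of slices. -/

section Dimension

variable {p : ℕ} [Fact p.Prime] {F : Type*} [Field F] [Algebra ℤ_[p] F]
  [Algebra ℚ_[p] F] [IsScalarTower ℤ_[p] ℚ_[p] F] [FiniteDimensional ℚ_[p] F] {n : ℕ}

theorem ringKrullDim_quotient_add_one_le {R : Type*} [CommRing R] {I J : Ideal R} [I.IsPrime]
    (h : I ≤ J) {r : R} (hrJ : r ∈ J) (hrI : r ∉ I) :
    ringKrullDim (R ⧸ J) + 1 ≤ ringKrullDim (R ⧸ I) :=
  ringKrullDim_succ_le_of_surjective (Ideal.Quotient.factor h) (Ideal.Quotient.factor_surjective h)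
    (r := Ideal.Quotient.mk I r)
    (mem_nonZeroDivisors_of_ne_zero (mt Ideal.Quotient.eq_zero_iff_mem.1 hrI))
    (by rwa [Ideal.Quotient.factor_mk, Ideal.Quotient.eq_zero_iff_mem])

theorem ringKrullDim_quotient_comap_of_surjective {S R : Type*} [CommRing S] [CommRing R]
    [Algebra S R] {σ : R →ₐ[S] R} (hσ : Function.Surjective σ) (Q : Ideal R) :
    ringKrullDim (R ⧸ Q.comap σ) = ringKrullDim (R ⧸ Q) :=
  ringKrullDim_eq_of_ringEquiv (RingEquiv.ofBijective (Ideal.quotientMap Q (σ : R →+* R) le_rfl)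
    ⟨Ideal.quotientMap_injective, Ideal.quotientMap_surjective hσ⟩)

theorem augIdeal_le_of_isMaximal (m : Ideal (MvPowerSeries (Fin n) (IntegerRing p F)))
    [m.IsMaximal] : augIdeal n (p : IntegerRing p F) ≤ m :=
  have := integerRing_isAdicComplete p F
  (augIdeal_le_jacobson _).trans (sInf_le ⟨bot_le, inferInstance⟩)

omit [Algebra ℚ_[p] F] [IsScalarTower ℤ_[p] ℚ_[p] F] [FiniteDimensional ℚ_[p] F] in
-- Such a prime is the contraction along `constantCoeff` of a prime of `𝓞_F` above `p`, and this is
-- maximal because `𝓞_F` is integral over `ℤ_p`.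
theorem isMaximal_of_augIdeal_le {P : Ideal (MvPowerSeries (Fin n) (IntegerRing p F))}
    [hP : P.IsPrime] (h : augIdeal n (p : IntegerRing p F) ≤ P) : P.IsMaximal := by
  have hpP : (p : IntegerRing p F) ∈ P.comap C := h (C_mem_augIdeal _)
  have hZ : ((P.comap C).comap (algebraMap ℤ_[p] (IntegerRing p F))).IsMaximal := by
    have hle : IsLocalRing.maximalIdeal ℤ_[p] ≤
        (P.comap C).comap (algebraMap ℤ_[p] (IntegerRing p F)) := by
      rw [PadicInt.maximalIdeal_eq_span_p, Ideal.span_singleton_le_iff_mem, Ideal.mem_comap,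
        map_natCast]
      exact hpP
    rw [← (IsLocalRing.maximalIdeal.isMaximal ℤ_[p]).eq_of_le Ideal.IsPrime.ne_top' hle]
    infer_instance
  have hO : (P.comap C).IsMaximal := Ideal.isMaximal_of_isIntegral_of_isMaximal_comap _ hZ
  have hX : ∀ i, Ideal.Quotient.mk P (X i) = 0 := fun i ↦
    Ideal.Quotient.eq_zero_iff_mem.2 (h (X_mem_augIdeal _ i))
  have heq : P = (P.comap C).comap (constantCoeff (σ := Fin n) (R := IntegerRing p F)) := by
    have := DFunLike.congr_fun (ringHom_ext_of_isHausdorff (⊥ : Ideal (_ ⧸ P))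
      (φ := Ideal.Quotient.mk P) (ψ := (Ideal.Quotient.mk P).comp (C.comp constantCoeff))
      (fun a ↦ by rw [RingHom.comp_apply, RingHom.comp_apply, constantCoeff_C])
      (fun i ↦ by rw [RingHom.comp_apply, RingHom.comp_apply, constantCoeff_X, map_zero, map_zero,
        hX])
      (fun i ↦ ⟨1, by rw [pow_one, hX]; exact zero_mem _⟩))
    ext f
    rw [← Ideal.Quotient.eq_zero_iff_mem, this f, RingHom.comp_apply,
      Ideal.Quotient.eq_zero_iff_mem]
    rfl
  rw [heq]
  exact Ideal.comap_isMaximal_of_surjective _ fun a ↦ ⟨C a, constantCoeff_C a⟩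

section Slices

variable {K : IntermediateField F (AlgebraicClosure F)} [FiniteDimensional F K] (T : Set (Fin n))
  {z : Fin n → IntegerRing p K} (hz : ∀ i, ∃ k : ℕ, z i ^ p ^ k = 1)
include hz

/-- A substitute with coefficients in `𝓞_F` for `X i - (z i - 1)`; together with the next lemma it
separates a slice from a hyperplane section of it. -/
theorem one_add_X_pow_sub_one_mem_sliceIdeal {i : Fin n} (hi : i ∈ T) {k : ℕ}
    (hk : z i ^ p ^ k = 1) : (1 + X i) ^ p ^ k - 1 ∈ sliceIdeal p K T z :=
  mem_sliceIdeal_of_forall_evalAt hz fun w hw ↦ by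
    rw [map_sub, map_pow, map_add, map_one, evalAt_X, add_sub_cancel, ← hw i hi, ← map_pow, hk,
      map_one, sub_self]

theorem one_add_X_pow_sub_one_notMem_sliceIdeal {i : Fin n} (hi : i ∉ T) (k : ℕ) :
    (1 + X i) ^ p ^ k - 1 ∉ sliceIdeal p K T z := by
  obtain ⟨w, hw⟩ := exists_torsionPoint_of_pow_eq_one K hz
  obtain ⟨u, hu⟩ := exists_isPrimitiveRoot p F (k + 1)
  intro hmem
  have h0 := sliceIdeal_le_ker_evalAt (w := Function.update w i u) hz (fun j hj ↦ by
    rw [Function.update_of_ne (by rintro rfl; exact hi hj), hw]) hmem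
  rw [RingHom.mem_ker, map_sub, map_pow, map_add, map_one, evalAt_X, add_sub_cancel,
    Function.update_self, sub_eq_zero, ← map_pow, map_eq_one_iff _ val_injective] at h0
  exact hu.pow_ne_one_of_pos_of_lt (pow_pos (Fact.out : p.Prime).pos _).ne'
    (Nat.pow_lt_pow_right (Fact.out : p.Prime).one_lt k.lt_succ_self) h0

theorem augIdeal_le_of_sliceIdeal_le {P : Ideal (MvPowerSeries (Fin n) (IntegerRing p F))}
    [P.IsPrime] (h : sliceIdeal p K T z ≤ P) (hp : C (p : IntegerRing p F) ∈ P)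
    (hX : ∀ i ∉ T, X i ∈ P) : augIdeal n (p : IntegerRing p F) ≤ P := by
  refine sup_le ((Ideal.span_singleton_le_iff_mem _).2 hp) (Ideal.span_le.2 ?_)
  rintro _ ⟨i, rfl⟩
  by_cases hi : i ∈ T
  · obtain ⟨k, hk⟩ := hz i
    obtain ⟨r, hr⟩ := exists_add_pow_prime_pow_eq (Fact.out : p.Prime)
      (1 : MvPowerSeries (Fin n) (IntegerRing p F)) (X i) k
    have h1 := h (one_add_X_pow_sub_one_mem_sliceIdeal T hz hi hk)
    rw [map_natCast] at hp
    refine Ideal.IsPrime.mem_of_pow_mem ‹_› (p ^ k) ?_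
    have h2 := P.sub_mem h1 (P.mul_mem_right (1 * X i * r) hp)
    convert h2 using 1
    rw [hr, one_pow]
    ring
  · exact hX i hi

/-- Krull's height theorem: on the slice every maximal ideal is minimal over `p` and the free
variables, because each fixed `X i` is nilpotent modulo `p`. -/
theorem ringKrullDim_quotient_sliceIdeal_le :
    ringKrullDim (MvPowerSeries (Fin n) (IntegerRing p F) ⧸ sliceIdeal p K T z) ≤
      (Tᶜ.ncard + 1 : ℕ) := by
  have := integerRing_isNoetherianRing p F
  set Q := sliceIdeal p K T z
  let s : Set (MvPowerSeries (Fin n) (IntegerRing p F) ⧸ Q) :=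
    Ideal.Quotient.mk Q '' insert (C (p : IntegerRing p F)) (X '' Tᶜ)
  have hs : s.encard ≤ (Tᶜ.ncard + 1 : ℕ) := by
    refine (Set.encard_image_le _ _).trans ((Set.encard_insert_le _ _).trans ?_)
    rw [Nat.cast_add, Nat.cast_one, (Set.toFinite Tᶜ).cast_ncard_eq]
    gcongr
    exact Set.encard_image_le _ _
  have hsfin : s.Finite := ((Set.toFinite _).insert _).image _
  rw [ringKrullDim_le_iff_isMaximal_height_le]
  intro m hm
  have hmem : m ∈ (Ideal.span s).minimalPrimes := by
    have hm' : (m.comap (Ideal.Quotient.mk Q)).IsMaximal :=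
      Ideal.comap_isMaximal_of_surjective _ Ideal.Quotient.mk_surjective
    have haug := augIdeal_le_of_isMaximal (m.comap (Ideal.Quotient.mk Q))
    refine ⟨⟨hm.isPrime, Ideal.span_le.2 ?_⟩, fun q ⟨hq, hqs⟩ hqm ↦ ?_⟩
    · rintro _ ⟨f, rfl | ⟨i, -, rfl⟩, rfl⟩
      · exact haug (C_mem_augIdeal _)
      · exact haug (X_mem_augIdeal _ i)
    · have hq' : (q.comap (Ideal.Quotient.mk Q)).IsMaximal := isMaximal_of_augIdeal_le
        (augIdeal_le_of_sliceIdeal_le T hz (fun f hf ↦ by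
            rw [Ideal.mem_comap, Ideal.Quotient.eq_zero_iff_mem.2 hf]
            exact zero_mem _)
          (hqs (Ideal.subset_span ⟨_, .inl rfl, rfl⟩))
          fun i hi ↦ hqs (Ideal.subset_span ⟨_, .inr ⟨i, hi, rfl⟩, rfl⟩))
      have := hq'.eq_of_le hm'.ne_top (Ideal.comap_mono hqm)
      exact (Ideal.comap_injective_of_surjective _ Ideal.Quotient.mk_surjective this).ge
  have h1 := (Ideal.height_le_card_of_mem_minimalPrimes_span hsfin hmem).trans
    (hsfin.cast_ncard_eq.trans_le hs)
  exact_mod_cast h1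

theorem one_le_ringKrullDim_quotient_sliceIdeal :
    1 ≤ ringKrullDim (MvPowerSeries (Fin n) (IntegerRing p F) ⧸ sliceIdeal p K T z) := by
  have hprime := isPrime_sliceIdeal T hz
  obtain ⟨w, hw⟩ := exists_torsionPoint_of_pow_eq_one K hz
  obtain ⟨m, hm, hle⟩ := Ideal.exists_le_maximal _ hprime.ne_top
  have h1 := ringKrullDim_quotient_add_one_le hle
    (augIdeal_le_of_isMaximal m (C_mem_augIdeal _)) (fun h ↦ ?_)
  · have : Nontrivial (MvPowerSeries (Fin n) (IntegerRing p F) ⧸ m) :=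
      Ideal.Quotient.nontrivial_iff.2 hm.ne_top
    refine le_trans ?_ h1
    exact le_add_of_nonneg_left ringKrullDim_nonneg_of_nontrivial
  · have h0 := sliceIdeal_le_ker_evalAt hz (fun j _ ↦ hw j) h
    have := charZero_of_injective_algebraMap (algebraMap ℚ_[p] (AlgebraicClosure F)).injective
    rw [RingHom.mem_ker, map_natCast, map_natCast] at h0
    exact (Fact.out : p.Prime).ne_zero
      (by exact_mod_cast congrArg (Subtype.val : ClosureRing p F → AlgebraicClosure F) h0)

/-- Fixing the free coordinates one at a time gives a strict chain of slices, and one further step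
comes from `p`, which lies in every maximal ideal but not in the ideal of a slice. -/
theorem le_ringKrullDim_quotient_sliceIdeal :
    ((Tᶜ.ncard + 1 : ℕ) : WithBot ℕ∞) ≤
      ringKrullDim (MvPowerSeries (Fin n) (IntegerRing p F) ⧸ sliceIdeal p K T z) := by
  induction h : Tᶜ.ncard generalizing T with
  | zero => exact_mod_cast one_le_ringKrullDim_quotient_sliceIdeal T hz
  | succ c ih =>
    obtain ⟨i, hi⟩ : Tᶜ.Nonempty := (Set.ncard_pos).1 (by omega)
    have hcard : (insert i T)ᶜ.ncard = c := by
      rw [show (insert i T)ᶜ = Tᶜ \ {i} by ext; simp [and_comm],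
        Set.ncard_sdiff_singleton_of_mem hi, h]
      rfl
    obtain ⟨k, hk⟩ := hz i
    have := isPrime_sliceIdeal T hz
    refine le_trans ?_ (ringKrullDim_quotient_add_one_le (sliceIdeal_mono (Set.subset_insert i T))
      (one_add_X_pow_sub_one_mem_sliceIdeal _ hz (Set.mem_insert i T) hk)
      (one_add_X_pow_sub_one_notMem_sliceIdeal T hz hi k))
    rw [Nat.cast_succ]
    gcongr
    exact ih _ hcard

theorem ringKrullDim_quotient_sliceIdeal :
    ringKrullDim (MvPowerSeries (Fin n) (IntegerRing p F) ⧸ sliceIdeal p K T z) =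
      (Tᶜ.ncard + 1 : ℕ) :=
  (ringKrullDim_quotient_sliceIdeal_le T hz).antisymm (le_ringKrullDim_quotient_sliceIdeal T hz)

end Slices

end Dimension
end FormalTorus

namespace FormalTorus

open MvPowerSeries

/-! ### From the closure of the special points to a special subscheme of exact dimension. -/

section SpecialSubschemes

open PrimeSpectrum in
theorem topologicalKrullDim_zeroLocus {A : Type*} [CommRing A] (J : Ideal A) :
    topologicalKrullDim (zeroLocus (J : Set A)) = ringKrullDim (A ⧸ J) := by
  have hs := Ideal.Quotient.mk_surjective (I := J)
  have he := (isClosedEmbedding_comap_of_surjective _ (Ideal.Quotient.mk J) hs).isEmbedding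
  have hr : Set.range (comap (Ideal.Quotient.mk J)) = zeroLocus (J : Set A) := by
    rw [range_comap_of_surjective _ _ hs, Ideal.mk_ker]
  rw [← topologicalKrullDim_eq_ringKrullDim]
  exact ((he.toHomeomorph.trans (Homeomorph.setCongr hr)).isHomeomorph.topologicalKrullDim_eq
    (X := PrimeSpectrum (A ⧸ J))).symm

open PrimeSpectrum in
theorem exists_le_ringKrullDim_quotient_of_closure {A : Type*} [CommRing A]
    {S : Set (PrimeSpectrum A)} {𝒟 : Set (Ideal A)} (hfin : 𝒟.Finite)
    (h : ∀ x ∈ S, ∃ D ∈ 𝒟, D ≤ x.asIdeal) {m : ℕ} (hm : m ≤ topologicalKrullDim (closure S)) :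
    ∃ D ∈ 𝒟, m ≤ ringKrullDim (A ⧸ D) := by
  have hcl : IsClosed (⋃ D ∈ 𝒟, zeroLocus (D : Set A)) :=
    hfin.isClosed_biUnion fun D _ ↦ isClosed_zeroLocus _
  have hsub : closure S ⊆ ⋃ D ∈ 𝒟, zeroLocus (D : Set A) := by
    refine closure_minimal (fun x hx ↦ ?_) hcl
    obtain ⟨D, hD, hle⟩ := h x hx
    exact Set.mem_biUnion hD hle
  rw [← zeroLocus_vanishingIdeal_eq_closure] at hm hsub
  rw [topologicalKrullDim_zeroLocus, ringKrullDim_quotient, Order.le_krullDim_iff] at hm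
  obtain ⟨l, rfl⟩ := hm
  -- Once the smallest prime of the chain contains `D`, the whole chain does.
  obtain ⟨D, hD, hle⟩ := Set.mem_iUnion₂.1 (hsub l.head.2)
  refine ⟨D, hD, ?_⟩
  rw [ringKrullDim_quotient, Order.le_krullDim_iff]
  have hmem : ∀ i, (l i).1 ∈ zeroLocus (D : Set A) := fun i ↦
    hle.trans (show l.head.1.asIdeal ≤ (l i).1.asIdeal from l.head_le i)
  exact ⟨⟨l.length, fun i ↦ ⟨(l i).1, hmem i⟩, fun i ↦ l.step i⟩, rfl⟩

variable {p : ℕ} [Fact p.Prime] {F : Type*} [Field F] [Algebra ℤ_[p] F]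
  [Algebra ℚ_[p] F] [IsScalarTower ℤ_[p] ℚ_[p] F] [FiniteDimensional ℚ_[p] F] {n : ℕ}

theorem exists_finite_isSpecialPrime (I : Ideal (MvPowerSeries (Fin n) (IntegerRing p F))) :
    ∃ 𝒟 : Set (Ideal (MvPowerSeries (Fin n) (IntegerRing p F))), 𝒟.Finite ∧
      (∀ D ∈ 𝒟, IsSpecialPrime D ∧ I ≤ D) ∧
      ∀ x ∈ specialPoints p I, ∃ D ∈ 𝒟, D ≤ x.asIdeal.comap (Ideal.Quotient.mk I) := by
  obtain ⟨𝒟, hfin, h1, h2⟩ := hasSpecialClosure_of_isClosed (isClosed_setOf_forall (p := p)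
    (F := F) (I : Set (MvPowerSeries (Fin n) (IntegerRing p F))))
  refine ⟨𝒟, hfin, fun D hD ↦ ⟨(h1 D hD).1, fun f hf ↦ (h1 D hD).2 f fun w hw ↦ hw f hf⟩, ?_⟩
  rintro x ⟨K, _, z, hz, hx⟩
  obtain ⟨w, hw⟩ := exists_torsionPoint_of_pow_eq_one K hz
  rw [hx, sliceIdeal_univ_eq_ker_evalAt hz hw]
  refine h2 w fun f hf ↦ ?_
  rw [← RingHom.mem_ker, ← sliceIdeal_univ_eq_ker_evalAt hz hw, ← hx, Ideal.mem_comap,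
    Ideal.Quotient.eq_zero_iff_mem.2 hf]
  exact zero_mem _

/-- A special prime of large dimension is contained in a special ideal of any smaller dimension. -/
theorem IsSpecialPrime.exists_ringKrullDim_eq
    {D : Ideal (MvPowerSeries (Fin n) (IntegerRing p F))} (hD : IsSpecialPrime D) {d : ℕ}
    (hd : (d + 1 : ℕ) ≤ ringKrullDim (MvPowerSeries (Fin n) (IntegerRing p F) ⧸ D)) :
    ∃ J, D ≤ J ∧ IsSpecialSubscheme p J ∧
      ringKrullDim (MvPowerSeries (Fin n) (IntegerRing p F) ⧸ J) = (d + 1 : ℕ) := by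
  obtain ⟨σ, hσ, hs, T, K, hK, z, hz, rfl⟩ := hD
  have hdim : ∀ T, ringKrullDim (MvPowerSeries (Fin n) (IntegerRing p F) ⧸
      (sliceIdeal p K T z).comap σ) = (Tᶜ.ncard + 1 : ℕ) := fun T ↦ by
    rw [← ringKrullDim_quotient_sliceIdeal T hz]
    exact ringKrullDim_quotient_comap_of_surjective hs _
  rw [hdim] at hd
  have hd' : d ≤ Tᶜ.ncard := by
    have : d + 1 ≤ Tᶜ.ncard + 1 := by exact_mod_cast hd
    omega
  -- `U` is the set of `d` coordinates left free; all others are fixed at the values `z`.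
  obtain ⟨U, hU, hcard⟩ := Set.exists_subset_card_eq hd'
  refine ⟨(sliceIdeal p K Uᶜ z).comap σ,
    Ideal.comap_mono (sliceIdeal_mono (Set.subset_compl_comm.1 hU)),
    ⟨σ, hσ, {sliceIdeal p K Uᶜ z}, Set.finite_singleton _, ?_, ?_⟩, ?_⟩
  · rintro _ rfl
    exact ⟨Uᶜ, K, hK, z, hz, rfl⟩
  · rw [sInf_singleton]
    exact Ideal.map_comap_of_surjective _ hs _
  · rw [hdim, compl_compl, hcard]

end SpecialSubschemes
end FormalTorus

theorem corollary2p16 (p : ℕ) [Fact p.Prime] (F : Type*) [Field F]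
    [Algebra ℚ_[p] F] [Algebra ℤ_[p] F] [IsScalarTower ℤ_[p] ℚ_[p] F] [FiniteDimensional ℚ_[p] F]
    (n : ℕ) (I : Ideal (MvPowerSeries (Fin n) (FormalTorus.IntegerRing p F))) (d : ℕ)
    (hd : FormalTorus.HasRelDim (closure (FormalTorus.specialPoints p I)) d) :
    ∃ J : Ideal (MvPowerSeries (Fin n) (FormalTorus.IntegerRing p F)),
      I ≤ J ∧ FormalTorus.IsSpecialSubscheme p J ∧
        FormalTorus.HasRelDim
          (PrimeSpectrum (MvPowerSeries (Fin n) (FormalTorus.IntegerRing p F) ⧸ J)) d := by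
  obtain ⟨𝒟, hfin, h1, h2⟩ := FormalTorus.exists_finite_isSpecialPrime I
  obtain ⟨_, ⟨D, hD, rfl⟩, hdim⟩ := FormalTorus.exists_le_ringKrullDim_quotient_of_closure
    (hfin.image fun D ↦ D.map (Ideal.Quotient.mk I)) (m := d + 1)
    (S := FormalTorus.specialPoints p I)
    (fun x hx ↦ by
      obtain ⟨D, hD, hle⟩ := h2 x hx
      exact ⟨_, ⟨D, hD, rfl⟩, Ideal.map_le_iff_le_comap.2 hle⟩)
    (by rw [hd]; push_cast; rfl)
  -- The dimension bound concerns the image of `D` in `R ⧸ I`; the surjection from `R ⧸ D` onto that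
  -- quotient carries it back to `D`.
  obtain ⟨J, hJ, hsp, hJdim⟩ := (h1 D hD).1.exists_ringKrullDim_eq
    (hdim.trans (ringKrullDim_le_of_surjective (Ideal.quotientMap (D.map (Ideal.Quotient.mk I))
      (Ideal.Quotient.mk I) Ideal.le_comap_map)
      (Ideal.quotientMap_surjective Ideal.Quotient.mk_surjective)))
  refine ⟨J, (h1 D hD).2.trans hJ, hsp, ?_⟩
  rw [FormalTorus.HasRelDim, PrimeSpectrum.topologicalKrullDim_eq_ringKrullDim, hJdim]
  push_cast
  rfl
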